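/- **Theorem 8.9 (low-degree hardness of covariance-aware robust mean testing).** *Setting.* Let $d,n\ge 1$, $\eta\in(0,1/2)$ and $\alpha>0$. For every unit vector $v\in\mathcal S^{d-1}$ let $\mu_v\in\mathbb R^d$, let $\Sigma_v\in\mathbb R^{d\times d}$ be positive definite with $\|\Sigma_v^{-1/2}\mu_v\|_2\ge\alpha$, and let $Q_v$ be a probability distribution on $\mathbb R^d$, such that the distribution $D_v:=(1-\eta)\,\mathcal N(\mu_v,\Sigma_v)+\eta\,Q_v$ depends measurably on $v$. The associated testing problem with input $y=(y_1,\dots,y_n)\in(\mathbb R^d)^n$ is to distinguish * $H_0$: $y_1,\dots,y_n$ are i.i.d. from $\mathcal N(0,I_d)$, and * $H_1$: $v$ is drawn uniformly from $\mathcal S^{d-1}$ and then, conditionally on $v$, $y_1,\dots,y_n$ are i.i.d. from $D_v$. Its degree-$D$ advantage is $$\mathrm{Adv}_{\le D,n}:=\sup_{f}\frac{\mathbb E_{H_1}[f(y)]}{\sqrt{\mathbb E_{H_0}[f(y)^2]}},$$ where $f$ ranges over the nonzero real polynomials of degree at most $D$ in the $nd$ coordinates of $y$. *Claim.* There are absolute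 constants $K>0$, $k\in\mathbb N$, $C\in\mathbb R$ and $c>0$ such that the following holds. Let $d\ge 1$, $\eta\in(0,1/2)$ with $\eta\ge K/\sqrt d$, and $\alpha>0$. Then there is a choice of $(\mu_v,\Sigma_v,Q_v)_{v\in\mathcal S^{d-1}}$ as above (depending only on $d,\eta,\alpha$) such that * every eigenvalue of $\Sigma_v$ is at least $c\,\min\left(\frac{\eta}{\alpha^2},\frac12\right)$, for every $v$; * for every $n$, all polynomials in $y$ are integrable under $H_1$; * $\mathrm{Adv}_{\le D,n}\le C$ for all $n,D\in\mathbb N$ with $Kd\le n$ and $K\,D^{k}\,n\le d^2\eta^2$. -/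

import Mathlib

open MeasureTheory ProbabilityTheory
open scoped MatrixOrder

noncomputable section

/-- The unit sphere of `ℝ^d`. -/
abbrev UnitSphere (d : ℕ) : Type :=
  Metric.sphere (0 : EuclideanSpace ℝ (Fin d)) 1

/-- The uniform probability measure on the unit sphere of `ℝ^d` (for `1 ≤ d`):
the normalized surface measure. -/
def uniformSphere (d : ℕ) : Measure (UnitSphere d) :=
  ((volume : Measure (EuclideanSpace ℝ (Fin d))).toSphere Set.univ)⁻¹ •
    (volume : Measure (EuclideanSpace ℝ (Fin d))).toSphere

/-- The value of a real polynomial in `n * d` variables at `y = (y₁, …, yₙ) ∈ (ℝ^d)^n`. -/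
def evalPoly {n d : ℕ} (f : MvPolynomial (Fin n × Fin d) ℝ)
    (y : Fin n → EuclideanSpace ℝ (Fin d)) : ℝ :=
  MvPolynomial.eval (fun p => y p.1 p.2) f

/-- The degree-`D` advantage for distinguishing `H₀ : y ∼ H0` from `H₁ : y ∼ H1`: the supremum of
`E_{H1}[f] / √(E_{H0}[f²])` over the polynomials `f` of degree at most `D` for which
the denominator is positive. The supremum is taken in the extended reals, so
that it is `⊤` when the ratios are unbounded. -/
def degreeAdvantage {n d : ℕ} (D : ℕ) (H0 H1 : Measure (Fin n → EuclideanSpace ℝ (Fin d))) :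
    EReal :=
  ⨆ (f : MvPolynomial (Fin n × Fin d) ℝ) (_ : f.totalDegree ≤ D)
    (_ : 0 < ∫ y, evalPoly f y ^ 2 ∂H0),
    (((∫ y, evalPoly f y ∂H1) / √(∫ y, evalPoly f y ^ 2 ∂H0) : ℝ) : EReal)

/-- The law of `n` i.i.d. samples from `N(0, I_d)`. -/
def nullLaw (n d : ℕ) : Measure (Fin n → EuclideanSpace ℝ (Fin d)) :=
  Measure.pi fun _ => stdGaussian (EuclideanSpace ℝ (Fin d))

/-- The mixture `(1 - η) N(μ, S) + η Q`. -/
def contaminatedGaussian {d : ℕ} (η : ℝ) (μ : EuclideanSpace ℝ (Fin d))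
    (S : Matrix (Fin d) (Fin d) ℝ) (Q : Measure (EuclideanSpace ℝ (Fin d))) :
    Measure (EuclideanSpace ℝ (Fin d)) :=
  ENNReal.ofReal (1 - η) • multivariateGaussian μ S + ENNReal.ofReal η • Q

/-- The Mahalanobis norm `‖S^{-1/2} μ‖₂`, for a positive definite matrix `S`. -/
def mahalanobisNorm {d : ℕ} (S : Matrix (Fin d) (Fin d) ℝ) (μ : EuclideanSpace ℝ (Fin d)) : ℝ :=
  ‖Matrix.toEuclideanCLM (𝕜 := ℝ) (CFC.sqrt S)⁻¹ μ‖

/-- A choice of the inlier means `μ_v`, the inlier covariances `Σ_v` and the outlier distributions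
`Q_v` (one for each unit vector `v`) that is admissible in the alternative hypothesis of
covariance-aware robust mean testing with corruption rate `η` and Mahalanobis norm `α`. -/
structure MeanTestingInstance (d : ℕ) (η α : ℝ) where
  /-- the inlier mean `μ_v` -/
  mean : UnitSphere d → EuclideanSpace ℝ (Fin d)
  /-- the inlier covariance `Σ_v` -/
  cov : UnitSphere d → Matrix (Fin d) (Fin d) ℝ
  /-- the outlier distribution `Q_v` -/
  outlier : UnitSphere d → Measure (EuclideanSpace ℝ (Fin d))
  cov_posDef : ∀ v, (cov v).PosDef
  outlier_isProbabilityMeasure : ∀ v, IsProbabilityMeasure (outlier v)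
  le_mahalanobisNorm : ∀ v, α ≤ mahalanobisNorm (cov v) (mean v)
  /-- the distribution of a sample depends measurably on `v`, so that `v` can be drawn at random -/
  measurable_sample : Measurable fun v => contaminatedGaussian η (mean v) (cov v) (outlier v)

namespace MeanTestingInstance

variable {d : ℕ} {η α : ℝ}

/-- The distribution `D_v = (1 - η) N(μ_v, Σ_v) + η Q_v` of one sample given `v`. -/
def sample (I : MeanTestingInstance d η α) (v : UnitSphere d) :
    Measure (EuclideanSpace ℝ (Fin d)) :=
  contaminatedGaussian η (I.mean v) (I.cov v) (I.outlier v)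

/-- The alternative hypothesis: first `v` is drawn uniformly from the unit sphere, then, given `v`,
`n` i.i.d. samples are drawn from `D_v`. -/
def altLaw (I : MeanTestingInstance d η α) (n : ℕ) :
    Measure (Fin n → EuclideanSpace ℝ (Fin d)) :=
  (uniformSphere d).bind fun v => Measure.pi fun _ => I.sample v

end MeanTestingInstance

end

/-!
The hard instance differs from `N(0, I)` only along the hidden direction `v`: there the inliers are
`N(a, s²)` with `a = α s` and `s² = min (η / α²) (1/2) / 4`, and the outliers sit on two points of size
`O(1 / √η)`, chosen so that the one-dimensional mixture has the first three moments of `N(0, 1)`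
(`exists_matching_parameters`). A distribution on two points can have any first three moments with
positive variance, and the choice of `s` keeps the required moments of the outliers bounded after
scaling by `√η`.

Each component of the mixture is the image of a standard Gaussian vector `y` under
`y ↦ y + (a + (b - 1)⟨v, y⟩) v`. Stein's identity shows that the expectation of a polynomial `F` under
this image is `∑ₜ κₜ / t! * E[∂_v^t F]`, where `κₜ = E[He_t(a + b g)]` (`gaussE_affineSubst`), and
`E[∂_v^t F] = E[F * He_t(⟨v, y⟩)]` (`gaussE_mul_hermiteForm`). For `n` samples and polynomials of degree
at most `D`, the expectation given `v` is therefore the correlation under the null law with a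
truncated likelihood ratio (`integral_evalPoly_eq_integral_mul_truncatedLR`). By Cauchy–Schwarz
(`sq_integral_integral_mul_le`) and the biorthogonality of Hermite polynomials, the square of the advantage
is at most the sum over the patterns `t₁ + ⋯ + tₙ ≤ D` of
`∏ᵢ (λ_{tᵢ}² / tᵢ!) * E⟨v, v'⟩ ^ (t₁ + ⋯ + tₙ)`, where `λₜ` are the Hermite moments of the mixture and
`v`, `v'` are independent uniform directions.

The overlap satisfies `E⟨v, v'⟩ ^ m ≤ (2 D / d) ^ (m / 2)` for `m ≤ D`
(`integral_inner_pow_le`). It follows that the sum is at most the `n`-th power of `∑ₜ λₜ² / t! * rᵗ` with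
`r² = 2 D / d` (`degreeAdvantage_le`). Since `λ₁ = λ₂ = λ₃ = 0` and `λₜ² / t! ≤ 4 η² (36 / η)ᵗ` for
`t ≥ 4`, this one-sample sum is at most `1 + 8 η² (36 r / η)⁴`, where the last term equals
`32 * 36⁴ * D² / (d² η²)`. Its `n`-th power is bounded once `n D²` is at most a small multiple of
`d² η²`.
-/

/-! ### Gaussian integration by parts for polynomials -/

open MvPolynomial in
/-- Polynomials grow at most polynomially in any upper bound for the coordinates. -/
theorem exists_abs_eval_le {σ : Type*} (F : MvPolynomial σ ℝ) :
    ∃ (C : ℝ) (m : ℕ), 0 ≤ C ∧ ∀ (x : σ → ℝ) (N : ℝ), 0 ≤ N → (∀ j, |x j| ≤ N) →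
      |eval x F| ≤ C * (1 + N) ^ m := by
  induction F using MvPolynomial.induction_on with
  | C a => exact ⟨|a|, 0, abs_nonneg a, fun x N _ _ => by simp⟩
  | add p q hp hq =>
    obtain ⟨A, m, hA, hp⟩ := hp
    obtain ⟨B, l, hB, hq⟩ := hq
    refine ⟨A + B, max m l, add_nonneg hA hB, fun x N hN hx => ?_⟩
    have h1 : (1 : ℝ) ≤ 1 + N := by linarith
    calc |eval x (p + q)| ≤ |eval x p| + |eval x q| := by rw [map_add]; exact abs_add_le _ _
      _ ≤ A * (1 + N) ^ m + B * (1 + N) ^ l := add_le_add (hp x N hN hx) (hq x N hN hx)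
      _ ≤ A * (1 + N) ^ max m l + B * (1 + N) ^ max m l := by
        gcongr
        · exact le_max_left _ _
        · exact le_max_right _ _
      _ = _ := by ring
  | mul_X p j hp =>
    obtain ⟨A, m, hA, hp⟩ := hp
    refine ⟨A, m + 1, hA, fun x N hN hx => ?_⟩
    rw [map_mul, eval_X, abs_mul, pow_succ, ← mul_assoc]
    exact mul_le_mul (hp x N hN hx) ((hx j).trans (by linarith)) (abs_nonneg _) (by positivity)

section GaussianFunctional

variable {ι : Type*}

open MvPolynomial in
/-- The derivative in direction `u`, as a derivation of the polynomial ring. -/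
noncomputable def dirDeriv (u : ι → ℝ) : Derivation ℝ (MvPolynomial ι ℝ) (MvPolynomial ι ℝ) :=
  mkDerivation ℝ fun j => C (u j)

open MvPolynomial in
@[simp] theorem dirDeriv_X (u : ι → ℝ) (j : ι) : dirDeriv u (X j) = C (u j) :=
  mkDerivation_X _ _ _

open MvPolynomial in
@[simp] theorem dirDeriv_C (u : ι → ℝ) (c : ℝ) : dirDeriv u (C c) = 0 :=
  derivation_C _ _

open MvPolynomial in
theorem dirDeriv_eq_zero_of_totalDegree (u : ι → ℝ) {F : MvPolynomial ι ℝ}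
    (h : F.totalDegree = 0) : dirDeriv u F = 0 := by
  rw [totalDegree_eq_zero_iff_eq_C.1 h, dirDeriv_C]

theorem continuous_eval_euclidean (F : MvPolynomial ι ℝ) :
    Continuous fun y : EuclideanSpace ℝ ι => MvPolynomial.eval (fun j => y j) F :=
  (MvPolynomial.continuous_eval F).comp (by fun_prop)

variable [Fintype ι]

theorem integrable_one_add_norm_pow_stdGaussian (m : ℕ) :
    Integrable (fun y => (1 + ‖y‖) ^ m) (stdGaussian (EuclideanSpace ℝ ι)) := by
  have h0 : MemLp (fun y : EuclideanSpace ℝ ι => ‖y‖) m (stdGaussian (EuclideanSpace ℝ ι)) :=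
    (IsGaussian.memLp_id (stdGaussian (EuclideanSpace ℝ ι)) (m : ENNReal) (by simp)).norm
  have h1 : MemLp (fun _ : EuclideanSpace ℝ ι => (1 : ℝ)) m (stdGaussian (EuclideanSpace ℝ ι)) :=
    memLp_const 1
  have h : MemLp (fun y : EuclideanSpace ℝ ι => 1 + ‖y‖) m (stdGaussian (EuclideanSpace ℝ ι)) :=
    h1.add h0
  have h2 := h.integrable_norm_pow'
  refine h2.congr (.of_forall fun y => ?_)
  change ‖1 + ‖y‖‖ ^ m = _
  rw [Real.norm_of_nonneg (by positivity)]

theorem integrable_eval_stdGaussian (F : MvPolynomial ι ℝ) :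
    Integrable (fun y => MvPolynomial.eval (fun j => y j) F)
      (stdGaussian (EuclideanSpace ℝ ι)) := by
  obtain ⟨C, m, hC, h⟩ := exists_abs_eval_le F
  refine ((integrable_one_add_norm_pow_stdGaussian m).const_mul C).mono'
    (continuous_eval_euclidean F).aestronglyMeasurable (.of_forall fun y => ?_)
  exact h _ _ (norm_nonneg y) fun j => PiLp.norm_apply_le y j

/-- The expectation of a polynomial under the standard Gaussian distribution, as a linear functional
on the polynomial ring. -/
noncomputable def gaussE : MvPolynomial ι ℝ →ₗ[ℝ] ℝ where
  toFun F := ∫ y, MvPolynomial.eval (fun j => y j) F ∂stdGaussian (EuclideanSpace ℝ ι)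
  map_add' F G := by
    simp only [map_add]
    exact integral_add (integrable_eval_stdGaussian F) (integrable_eval_stdGaussian G)
  map_smul' c F := by
    simp only [MvPolynomial.smul_eval, RingHom.id_apply, smul_eq_mul]
    exact integral_const_mul _ _

theorem gaussE_apply (F : MvPolynomial ι ℝ) :
    gaussE F = ∫ y, MvPolynomial.eval (fun j => y j) F ∂stdGaussian (EuclideanSpace ℝ ι) := rfl

@[simp] theorem gaussE_one : gaussE (1 : MvPolynomial ι ℝ) = 1 := by
  simp [gaussE_apply]

theorem gaussE_C_mul (c : ℝ) (F : MvPolynomial ι ℝ) :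
    gaussE (MvPolynomial.C c * F) = c * gaussE F := by
  rw [← MvPolynomial.smul_eq_C_mul, map_smul, smul_eq_mul]

/-- Integration by parts for the one-dimensional Gaussian moments. -/
theorem integral_pow_succ_gaussianReal (k : ℕ) :
    ∫ x, x ^ (k + 1) ∂gaussianReal 0 1 = k * ∫ x, x ^ (k - 1) ∂gaussianReal 0 1 := by
  have hint : ∀ l : ℕ, Integrable (fun x : ℝ => gaussianPDFReal 0 1 x * x ^ l) := by
    intro l
    have h : Integrable (fun x : ℝ => x ^ l) (gaussianReal 0 1) := by
      have := (memLp_id_gaussianReal' (μ := 0) (v := 1) (l : ENNReal) (by simp)).integrable_norm_pow'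
      refine this.mono (by fun_prop) (.of_forall fun x => by simp)
    rw [gaussianReal_of_var_ne_zero _ one_ne_zero, integrable_withDensity_iff
      (measurable_gaussianPDF _ _) (.of_forall fun _ => gaussianPDF_lt_top)] at h
    refine h.congr (.of_forall fun x => ?_)
    simp [toReal_gaussianPDF, mul_comm]
  have hd : ∀ x : ℝ, HasDerivAt (fun x : ℝ => gaussianPDFReal 0 1 x * x ^ k)
      (k * (gaussianPDFReal 0 1 x * x ^ (k - 1)) - gaussianPDFReal 0 1 x * x ^ (k + 1)) x := by
    intro x
    have h1 : HasDerivAt (fun x : ℝ => gaussianPDFReal 0 1 x) (-x * gaussianPDFReal 0 1 x) x := by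
      unfold gaussianPDFReal
      have h2 : HasDerivAt (fun x : ℝ => -(x - 0) ^ 2 / (2 * ((1 : NNReal) : ℝ))) (-x) x := by
        have := (((hasDerivAt_id x).sub_const 0).pow 2).neg.div_const (2 * ((1 : NNReal) : ℝ))
        convert! this using 1
        simp only [id_eq, sub_zero, NNReal.coe_one]
        norm_num
        ring
      have := (h2.exp).const_mul (√(2 * Real.pi * ((1 : NNReal) : ℝ)))⁻¹
      convert! this using 1
      ring
    convert! h1.mul (hasDerivAt_pow k x) using 1
    ring
  have key := integral_eq_zero_of_hasDerivAt_of_integrable hd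
    (((hint (k - 1)).const_mul _).sub (hint (k + 1))) (hint k)
  rw [integral_sub ((hint (k - 1)).const_mul _) (hint (k + 1)), integral_const_mul] at key
  simp only [integral_gaussianReal_eq_integral_smul one_ne_zero, smul_eq_mul]
  linarith

open MvPolynomial in
theorem gaussE_monomial (s : ι →₀ ℕ) (c : ℝ) :
    gaussE (monomial s c) = c * ∏ j, ∫ x, x ^ s j ∂gaussianReal 0 1 := by
  rw [gaussE_apply, ← map_pi_eq_stdGaussian, integral_map (by fun_prop)
    (continuous_eval_euclidean _).aestronglyMeasurable]
  simp only [eval_monomial, Finsupp.prod_fintype _ _ (fun _ => pow_zero _)]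
  rw [integral_const_mul, integral_fintype_prod_eq_prod (f := fun j x => x ^ s j)]

open MvPolynomial in
/-- Stein's identity for a coordinate. -/
theorem gaussE_X_mul (i : ι) (F : MvPolynomial ι ℝ) :
    gaussE (X i * F) = gaussE (pderiv i F) := by
  classical
  induction F using MvPolynomial.induction_on' with
  | add F G hF hG => rw [mul_add, map_add, map_add, map_add, hF, hG]
  | monomial s a =>
    have h : (X i * monomial s a : MvPolynomial ι ℝ) = monomial (Finsupp.single i 1 + s) a := by
      rw [X, monomial_mul, one_mul]
    rw [h, pderiv_monomial, gaussE_monomial, gaussE_monomial,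
      ← Finset.mul_prod_erase _ _ (Finset.mem_univ i),
      ← Finset.mul_prod_erase (Finset.univ) (fun j => ∫ x, x ^ (s - Finsupp.single i 1 : ι →₀ ℕ) j
        ∂gaussianReal 0 1) (Finset.mem_univ i)]
    have h1 : ∀ j ∈ Finset.univ.erase i, ((Finsupp.single i 1 + s : ι →₀ ℕ) j) = s j := by
      intro j hj
      simp [Finsupp.single_eq_of_ne (Finset.ne_of_mem_erase hj)]
    have h2 : ∀ j ∈ Finset.univ.erase i, ((s - Finsupp.single i 1 : ι →₀ ℕ) j) = s j := by
      intro j hj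
      simp [Finsupp.single_eq_of_ne (Finset.ne_of_mem_erase hj)]
    have h5 := Finset.prod_congr (rfl : Finset.univ.erase i = _) fun j hj =>
      congrArg (fun k => ∫ x : ℝ, x ^ k ∂gaussianReal 0 1) ((h1 j hj).trans (h2 j hj).symm)
    rw [h5]
    have h3 : ((Finsupp.single i 1 + s : ι →₀ ℕ) i) = s i + 1 := by simp [add_comm]
    have h4 : ((s - Finsupp.single i 1 : ι →₀ ℕ) i) = s i - 1 := by simp
    rw [h3, h4, integral_pow_succ_gaussianReal]
    ring

/-- The linear form `y ↦ ⟨u, y⟩`, as a polynomial. -/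
noncomputable def linForm (u : ι → ℝ) : MvPolynomial ι ℝ :=
  ∑ j, MvPolynomial.C (u j) * MvPolynomial.X j

open MvPolynomial

theorem dirDeriv_linForm (u v : ι → ℝ) : dirDeriv u (linForm v) = C (∑ j, u j * v j) := by
  simp [linForm, map_sum, Derivation.leibniz, mul_comm]

theorem dirDeriv_eq_sum (u : ι → ℝ) (F : MvPolynomial ι ℝ) :
    dirDeriv u F = ∑ j, C (u j) * pderiv j F := by
  classical
  have h : dirDeriv u = ∑ j, (C (u j) : MvPolynomial ι ℝ) • pderiv j := by
    refine derivation_ext fun i => ?_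
    rw [dirDeriv_X, ← Derivation.coeFnAddMonoidHom_apply, map_sum, Finset.sum_apply]
    simp [pderiv_X, Pi.single_apply]
  rw [h, ← Derivation.coeFnAddMonoidHom_apply, map_sum, Finset.sum_apply]
  simp

theorem dirDeriv_add_smul (u v : ι → ℝ) (c : ℝ) (F : MvPolynomial ι ℝ) :
    dirDeriv (u + c • v) F = dirDeriv u F + C c * dirDeriv v F := by
  simp only [dirDeriv_eq_sum, Finset.mul_sum, ← Finset.sum_add_distrib]
  exact Finset.sum_congr rfl fun j _ => by simp; ring

/-- Stein's identity: `E[⟨u, y⟩ F(y)] = E[∂_u F(y)]`. -/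
theorem gaussE_linForm_mul (u : ι → ℝ) (F : MvPolynomial ι ℝ) :
    gaussE (linForm u * F) = gaussE (dirDeriv u F) := by
  rw [dirDeriv_eq_sum, linForm, Finset.sum_mul, map_sum, map_sum]
  exact Finset.sum_congr rfl fun j _ => by
    rw [mul_assoc, gaussE_C_mul, gaussE_C_mul, gaussE_X_mul]

theorem totalDegree_dirDeriv_le (u : ι → ℝ) (F : MvPolynomial ι ℝ) :
    (dirDeriv u F).totalDegree ≤ F.totalDegree - 1 := by
  classical
  rw [dirDeriv_eq_sum]
  refine (totalDegree_finsetSum _ _).trans (Finset.sup_le fun j _ => ?_)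
  refine (totalDegree_mul _ _).trans ?_
  rw [totalDegree_C, zero_add]
  conv_lhs => rw [F.as_sum, map_sum]
  refine (totalDegree_finsetSum _ _).trans (Finset.sup_le fun s hs => ?_)
  rw [pderiv_monomial]
  by_cases h : s j = 0
  · simp [h]
  · refine (totalDegree_monomial_le _ _).trans ?_
    have h1 : s.sum (fun _ e => e) ≤ F.totalDegree := le_totalDegree hs
    have h2 : (s - Finsupp.single j 1) + Finsupp.single j 1 = s :=
      tsub_add_cancel_of_le (by simpa using Nat.one_le_iff_ne_zero.2 h)
    have h3 : (s - Finsupp.single j 1).degree + 1 = s.degree := by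
      conv_rhs => rw [← h2]
      simp
    have h4 : s.sum (fun _ e => e) = s.degree := rfl
    change (s - Finsupp.single j 1).degree ≤ _
    omega

theorem dirDeriv_iterate_eq_zero (u : ι → ℝ) {t : ℕ} :
    ∀ {F : MvPolynomial ι ℝ}, F.totalDegree < t → (dirDeriv u)^[t] F = 0 := by
  induction t with
  | zero => intro F h; omega
  | succ t ih =>
    intro F h
    rw [Function.iterate_succ_apply]
    by_cases h0 : F.totalDegree = 0
    · rw [dirDeriv_eq_zero_of_totalDegree u h0, iterate_map_zero]
    · exact ih (lt_of_le_of_lt (totalDegree_dirDeriv_le u F) (by omega))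

end GaussianFunctional

/-! ### Hermite expansion of affine images of the Gaussian -/

section AffineImage

open MvPolynomial

variable {ι : Type*}

theorem dirDeriv_comm (u v : ι → ℝ) (F : MvPolynomial ι ℝ) :
    dirDeriv u (dirDeriv v F) = dirDeriv v (dirDeriv u F) := by
  induction F using MvPolynomial.induction_on with
  | C c => simp
  | add p q hp hq => simp only [map_add, hp, hq]
  | mul_X p j hp =>
    simp only [Derivation.leibniz, smul_eq_mul, map_add, dirDeriv_X, dirDeriv_C, hp]
    ring

theorem dirDeriv_X_mul (u : ι → ℝ) (j : ι) (F : MvPolynomial ι ℝ) :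
    dirDeriv u (X j * F) = X j * dirDeriv u F + C (u j) * F := by
  rw [Derivation.leibniz, dirDeriv_X, smul_eq_mul, smul_eq_mul, mul_comm F]

theorem dirDeriv_iterate_X_mul (u : ι → ℝ) (j : ι) (t : ℕ) (F : MvPolynomial ι ℝ) :
    (dirDeriv u)^[t] (X j * F)
      = X j * (dirDeriv u)^[t] F + C (t * u j) * (dirDeriv u)^[t - 1] F := by
  induction t with
  | zero => simp
  | succ t ih =>
    rw [Function.iterate_succ_apply', ih, map_add, dirDeriv_X_mul, Derivation.leibniz,
      dirDeriv_C, smul_zero, add_zero, smul_eq_mul, ← Function.iterate_succ_apply' (dirDeriv u),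
      Nat.add_sub_cancel]
    cases t with
    | zero => simp
    | succ t =>
      rw [Nat.add_sub_cancel, ← Function.iterate_succ_apply' (dirDeriv u)]
      simp only [Nat.succ_eq_add_one, Nat.cast_add, Nat.cast_one, map_mul, map_add, map_one]
      ring

variable [Fintype ι]

/-- The substitution `F(y) ↦ F(y + (a + (b - 1)⟨v, y⟩) v)`: for a unit vector `v`, it replaces the
component `⟨v, y⟩` by `a + b⟨v, y⟩` and leaves the orthogonal complement of `v` alone. -/
noncomputable def affineSubst (a b : ℝ) (v : ι → ℝ) : MvPolynomial ι ℝ →ₐ[ℝ] MvPolynomial ι ℝ :=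
  aeval fun j => X j + C (v j) * (C a + C (b - 1) * linForm v)

/-- The moments `E[He_t(a + b g)]` of the Hermite polynomials under `N(a, b²)`, defined through their
recurrence. -/
noncomputable def hermiteMoment (a b : ℝ) : ℕ → ℝ
  | 0 => 1
  | 1 => a
  | t + 2 => a * hermiteMoment a b (t + 1) + (b ^ 2 - 1) * (t + 1) * hermiteMoment a b t

theorem hermiteMoment_succ (a b : ℝ) (t : ℕ) :
    hermiteMoment a b (t + 1)
      = a * hermiteMoment a b t + (b ^ 2 - 1) * t * hermiteMoment a b (t - 1) := by
  cases t with
  | zero => simp [hermiteMoment]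
  | succ t => simp [hermiteMoment]

/-- The chain rule for `affineSubst`. -/
theorem dirDeriv_affineSubst (a b : ℝ) (u v : ι → ℝ) (F : MvPolynomial ι ℝ) :
    dirDeriv u (affineSubst a b v F)
      = affineSubst a b v (dirDeriv (u + ((b - 1) * ∑ j, u j * v j) • v) F) := by
  induction F using MvPolynomial.induction_on with
  | C c => simp [affineSubst, algebraMap_eq]
  | add p q hp hq => simp only [map_add, hp, hq]
  | mul_X p j hp =>
    have hX : dirDeriv u (affineSubst a b v (X j))
        = affineSubst a b v (dirDeriv (u + ((b - 1) * ∑ j, u j * v j) • v) (X j)) := by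
      simp only [affineSubst, aeval_X, map_add, Derivation.leibniz, dirDeriv_X, dirDeriv_C,
        dirDeriv_linForm, smul_eq_mul, aeval_C, algebraMap_eq, Pi.add_apply, Pi.smul_apply, map_mul]
      ring
    simp only [map_mul, Derivation.leibniz, smul_eq_mul, hp, hX, map_add]

theorem gaussE_affineSubst_X_mul [DecidableEq ι] (a b : ℝ) {v : ι → ℝ} (hv : ∑ j, v j * v j = 1)
    (j : ι) (F : MvPolynomial ι ℝ) :
    gaussE (affineSubst a b v (X j * F)) = gaussE (affineSubst a b v (pderiv j F))
      + v j * (a * gaussE (affineSubst a b v F)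
        + (b ^ 2 - 1) * gaussE (affineSubst a b v (dirDeriv v F))) := by
  have hpd : ∀ G : MvPolynomial ι ℝ, pderiv j G = dirDeriv (Pi.single j 1) G := fun G => by
    rw [dirDeriv_eq_sum]
    simp [Pi.single_apply]
  have h1 : gaussE (X j * affineSubst a b v F) = gaussE (affineSubst a b v (pderiv j F))
      + (b - 1) * v j * gaussE (affineSubst a b v (dirDeriv v F)) := by
    rw [gaussE_X_mul, hpd, hpd, dirDeriv_affineSubst, dirDeriv_add_smul, map_add, map_mul, map_add]
    simp only [affineSubst, aeval_C, algebraMap_eq, gaussE_C_mul]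
    simp [Pi.single_apply]
  have h2 : gaussE (linForm v * affineSubst a b v F)
      = b * gaussE (affineSubst a b v (dirDeriv v F)) := by
    have h3 : v + ((b - 1) * ∑ j, v j * v j) • v = 0 + b • v := by
      rw [hv]; module
    have h4 : dirDeriv (0 : ι → ℝ) F = 0 := by rw [dirDeriv_eq_sum]; simp
    rw [gaussE_linForm_mul, dirDeriv_affineSubst, h3, dirDeriv_add_smul, h4, zero_add, map_mul]
    simp only [affineSubst, aeval_C, algebraMap_eq, gaussE_C_mul]
  have h5 : affineSubst a b v (X j * F) = X j * affineSubst a b v F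
      + (C (v j * a) * affineSubst a b v F
        + C (v j * (b - 1)) * (linForm v * affineSubst a b v F)) := by
    rw [map_mul]
    simp only [affineSubst, aeval_X, map_mul]
    ring
  rw [h5, map_add, map_add, gaussE_C_mul, gaussE_C_mul, h1, h2]
  ring

/-- The Hermite expansion of the affine images of the Gaussian: `E F(T y)` is the sum over `t` of
`E[He_t(a + b g)] / t! * E[∂_v^t F(y)]`. Both sides satisfy the same recursion in `F`. -/
theorem gaussE_affineSubst (a b : ℝ) {v : ι → ℝ} (hv : ∑ j, v j * v j = 1) (N : ℕ)
    (F : MvPolynomial ι ℝ) (hF : F.totalDegree < N) :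
    gaussE (affineSubst a b v F)
      = ∑ t ∈ Finset.range N, hermiteMoment a b t / t.factorial * gaussE ((dirDeriv v)^[t] F) := by
  classical
  have hpd : ∀ (j : ι) (G : MvPolynomial ι ℝ), pderiv j G = dirDeriv (Pi.single j 1) G := by
    intro j G
    rw [dirDeriv_eq_sum]
    simp [Pi.single_apply]
  have hpdc : ∀ (j : ι) (t : ℕ) (G : MvPolynomial ι ℝ),
      pderiv j ((dirDeriv v)^[t] G) = (dirDeriv v)^[t] (pderiv j G) := by
    intro j t G
    induction t generalizing G with
    | zero => rfl
    | succ t ih => rw [Function.iterate_succ_apply, ih, hpd, dirDeriv_comm, ← hpd,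
        Function.iterate_succ_apply]
  have key : ∀ m, m < N → ∀ F : MvPolynomial ι ℝ, F.totalDegree ≤ m →
      gaussE (affineSubst a b v F) = ∑ t ∈ Finset.range N,
        hermiteMoment a b t / t.factorial * gaussE ((dirDeriv v)^[t] F) := by
    intro m
    induction m with
    | zero =>
      intro hm F hF
      obtain ⟨N, rfl⟩ : ∃ M, N = M + 1 := ⟨N - 1, by omega⟩
      have h0 : F.totalDegree = 0 := by omega
      rw [Finset.sum_range_succ', Finset.sum_eq_zero, totalDegree_eq_zero_iff_eq_C.1 h0]
      · simp [affineSubst, hermiteMoment, algebraMap_eq]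
      · intro t _
        rw [dirDeriv_iterate_eq_zero v (by omega), map_zero, mul_zero]
    | succ m ih =>
      intro hm F hF
      have ih := ih (by omega)
      -- It is enough to consider the products `X j * G` with `G` of lower degree.
      have hXG : ∀ (j : ι) (G : MvPolynomial ι ℝ), G.totalDegree ≤ m →
          gaussE (affineSubst a b v (X j * G)) = ∑ t ∈ Finset.range N,
            hermiteMoment a b t / t.factorial * gaussE ((dirDeriv v)^[t] (X j * G)) := by
        intro j G hG
        have e1 : (pderiv j G).totalDegree ≤ m := by
          rw [hpd]; exact (totalDegree_dirDeriv_le _ _).trans (by omega)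
        have e2 : (dirDeriv v G).totalDegree ≤ m :=
          (totalDegree_dirDeriv_le _ _).trans (by omega)
        rw [gaussE_affineSubst_X_mul a b hv, ih _ e1, ih _ hG, ih _ e2]
        simp_rw [dirDeriv_iterate_X_mul, map_add, gaussE_X_mul, hpdc, gaussE_C_mul, mul_add]
        rw [Finset.sum_add_distrib]
        congr 1
        obtain ⟨N, rfl⟩ : ∃ M, N = M + 1 := ⟨N - 1, by omega⟩
        have z1 : (dirDeriv v)^[N] G = 0 := dirDeriv_iterate_eq_zero v (by omega)
        have z2 : (dirDeriv v)^[N] (dirDeriv v G) = 0 := by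
          rw [← Function.iterate_succ_apply, Function.iterate_succ_apply', z1, map_zero]
        -- The right-hand side is reindexed by `t + 1`, and the recurrence is used.
        rw [Finset.sum_range_succ' (fun t => hermiteMoment a b t / t.factorial *
          (t * v j * gaussE ((dirDeriv v)^[t - 1] G)))]
        simp only [Nat.cast_zero, zero_mul, mul_zero, add_zero, Nat.add_sub_cancel]
        have r1 : ∀ t : ℕ, hermiteMoment a b (t + 1) / (t + 1).factorial *
            (((t + 1 : ℕ) : ℝ) * v j * gaussE ((dirDeriv v)^[t] G))
            = v j * (a * (hermiteMoment a b t / t.factorial * gaussE ((dirDeriv v)^[t] G))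
              + (b ^ 2 - 1) * (t * hermiteMoment a b (t - 1) / t.factorial
                * gaussE ((dirDeriv v)^[t] G))) := by
          intro t
          have : (t.factorial : ℝ) ≠ 0 := by positivity
          rw [hermiteMoment_succ, Nat.factorial_succ]
          push_cast
          field_simp
        have hS1 : ∑ t ∈ Finset.range (N + 1), hermiteMoment a b t / t.factorial *
            gaussE ((dirDeriv v)^[t] G) = ∑ t ∈ Finset.range N, hermiteMoment a b t / t.factorial *
            gaussE ((dirDeriv v)^[t] G) := by
          rw [Finset.sum_range_succ, z1, map_zero, mul_zero, add_zero]
        have hS2 : ∑ t ∈ Finset.range (N + 1), hermiteMoment a b t / t.factorial *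
            gaussE ((dirDeriv v)^[t] (dirDeriv v G)) = ∑ t ∈ Finset.range N,
            t * hermiteMoment a b (t - 1) / t.factorial * gaussE ((dirDeriv v)^[t] G) := by
          cases N with
          | zero => simp [dirDeriv_eq_zero_of_totalDegree v (F := G) (by omega)]
          | succ N =>
            rw [Finset.sum_range_succ' (fun t => (t : ℝ) * hermiteMoment a b (t - 1) / t.factorial
              * gaussE ((dirDeriv v)^[t] G)), Finset.sum_range_succ, Finset.sum_range_succ, z2,
              ← Function.iterate_succ_apply, z1]
            simp only [map_zero, mul_zero, add_zero, Nat.cast_zero, zero_mul, zero_div,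
              Nat.add_sub_cancel]
            refine Finset.sum_congr rfl fun t _ => ?_
            have : (t.factorial : ℝ) ≠ 0 := by positivity
            rw [Nat.factorial_succ, Function.iterate_succ_apply]
            push_cast
            field_simp
        simp_rw [r1]
        rw [← Finset.mul_sum, Finset.sum_add_distrib, ← Finset.mul_sum, ← Finset.mul_sum, hS1, hS2]
        ring
      have hmon : ∀ s ∈ F.support, gaussE (affineSubst a b v (monomial s (coeff s F)))
          = ∑ t ∈ Finset.range N, hermiteMoment a b t / t.factorial
            * gaussE ((dirDeriv v)^[t] (monomial s (coeff s F))) := by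
        intro s hs
        have hdeg : s.degree ≤ m + 1 := (le_totalDegree hs).trans hF
        by_cases h0 : s = 0
        · refine ih _ ?_
          rw [h0]
          change (C _ : MvPolynomial ι ℝ).totalDegree ≤ m
          rw [totalDegree_C]
          omega
        · obtain ⟨j, hj⟩ := Finsupp.ne_iff.1 h0
          have h2 : (s - Finsupp.single j 1) + Finsupp.single j 1 = s :=
            tsub_add_cancel_of_le (by simpa using Nat.one_le_iff_ne_zero.2 hj)
          have h3 : (s - Finsupp.single j 1).degree + 1 = s.degree := by
            conv_rhs => rw [← h2]
            simp
          have h4 : monomial s (coeff s F)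
              = X j * monomial (s - Finsupp.single j 1) (coeff s F) := by
            rw [X, monomial_mul, one_mul, add_comm, h2]
          rw [h4]
          refine hXG j _ ((totalDegree_monomial_le _ _).trans ?_)
          change (s - Finsupp.single j 1).degree ≤ m
          omega
      have hsum : ∀ t, (dirDeriv v)^[t] F
          = ∑ s ∈ F.support, (dirDeriv v)^[t] (monomial s (coeff s F)) := by
        intro t
        conv_lhs => rw [F.as_sum]
        induction t with
        | zero => rfl
        | succ t ih => simp only [Function.iterate_succ_apply', ih, map_sum]
      simp_rw [hsum, map_sum, Finset.mul_sum]
      rw [Finset.sum_comm, ← Finset.sum_congr rfl hmon, ← map_sum, ← map_sum, ← F.as_sum]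
  exact key _ hF F le_rfl

/-- The Hermite polynomial `He_t` of the linear form `⟨v, y⟩`. -/
noncomputable def hermiteForm (v : ι → ℝ) (t : ℕ) : MvPolynomial ι ℝ :=
  Polynomial.aeval (linForm v) (Polynomial.hermite t)

theorem hermiteForm_succ (v : ι → ℝ) (t : ℕ) :
    hermiteForm v (t + 1) = linForm v * hermiteForm v t
      - Polynomial.aeval (linForm v) (Polynomial.derivative (Polynomial.hermite t)) := by
  simp [hermiteForm, Polynomial.hermite_succ]

theorem dirDeriv_aeval_linForm (u v : ι → ℝ) (p : Polynomial ℤ) :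
    dirDeriv u (Polynomial.aeval (linForm v) p)
      = C (∑ j, u j * v j) * Polynomial.aeval (linForm v) (Polynomial.derivative p) := by
  induction p using Polynomial.induction_on' with
  | add p q hp hq => simp only [map_add, hp, hq, mul_add]
  | monomial k c =>
    rw [Polynomial.derivative_monomial, Polynomial.aeval_monomial, Polynomial.aeval_monomial,
      Derivation.leibniz, Derivation.leibniz_pow, dirDeriv_linForm]
    simp
    ring

/-- Iterated Stein identity: `E[F(y) He_t(⟨v, y⟩)] = E[∂_v^t F(y)]`. -/
theorem gaussE_mul_hermiteForm {v : ι → ℝ} (hv : ∑ j, v j * v j = 1) (t : ℕ)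
    (F : MvPolynomial ι ℝ) :
    gaussE (F * hermiteForm v t) = gaussE ((dirDeriv v)^[t] F) := by
  induction t generalizing F with
  | zero => simp [hermiteForm]
  | succ t ih =>
    rw [Function.iterate_succ_apply, ← ih, hermiteForm_succ, mul_sub, map_sub]
    have h : F * (linForm v * hermiteForm v t) = linForm v * (F * hermiteForm v t) := by ring
    rw [h, gaussE_linForm_mul, Derivation.leibniz, map_add, smul_eq_mul, smul_eq_mul]
    have h2 : dirDeriv v (hermiteForm v t)
        = Polynomial.aeval (linForm v) (Polynomial.derivative (Polynomial.hermite t)) := by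
      rw [hermiteForm, dirDeriv_aeval_linForm, hv, map_one, one_mul]
    rw [h2, mul_comm (hermiteForm v t)]
    ring

theorem dirDeriv_iterate_aeval_linForm (u v : ι → ℝ) (t : ℕ) (p : Polynomial ℤ) :
    (dirDeriv u)^[t] (Polynomial.aeval (linForm v) p) = C ((∑ j, u j * v j) ^ t) *
      Polynomial.aeval (linForm v) (Polynomial.derivative^[t] p) := by
  induction t generalizing p with
  | zero => simp
  | succ t ih =>
    rw [Function.iterate_succ_apply', ih, Derivation.leibniz, dirDeriv_C, smul_zero, add_zero,
      dirDeriv_aeval_linForm, Function.iterate_succ_apply', smul_eq_mul, pow_succ, map_mul]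
    ring

/-- The Hermite polynomials of two linear forms are biorthogonal. -/
theorem gaussE_hermiteForm_mul_hermiteForm {u v : ι → ℝ} (hu : ∑ j, u j * u j = 1)
    (hv : ∑ j, v j * v j = 1) (s t : ℕ) :
    gaussE (hermiteForm u s * hermiteForm v t)
      = if s = t then (t.factorial : ℝ) * (∑ j, u j * v j) ^ t else 0 := by
  -- Differentiating `He_t` more than `t` times gives zero.
  have hlt : ∀ {u v : ι → ℝ}, ∑ j, v j * v j = 1 → ∀ {s t : ℕ}, s < t →
      gaussE (hermiteForm u s * hermiteForm v t) = 0 := by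
    intro u v hv s t hst
    rw [gaussE_mul_hermiteForm hv, hermiteForm, dirDeriv_iterate_aeval_linForm,
      Polynomial.iterate_derivative_eq_zero (by rwa [Polynomial.natDegree_hermite])]
    simp
  rcases lt_trichotomy s t with h | h | h
  · rw [hlt hv h, if_neg h.ne]
  · subst h
    have h2 : Polynomial.derivative^[s] (Polynomial.hermite s)
        = Polynomial.C (s.factorial : ℤ) := by
      have hd : (Polynomial.derivative^[s] (Polynomial.hermite s)).natDegree = 0 := by
        have := Polynomial.natDegree_iterate_derivative (Polynomial.hermite s) s
        rw [Polynomial.natDegree_hermite] at this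
        omega
      rw [Polynomial.eq_C_of_natDegree_eq_zero hd, Polynomial.coeff_iterate_derivative]
      simp [Nat.descFactorial_self, Polynomial.coeff_hermite_self]
    rw [if_pos rfl, gaussE_mul_hermiteForm hv, hermiteForm, dirDeriv_iterate_aeval_linForm, h2,
      gaussE_C_mul]
    have h3 : (∑ j, v j * u j) = ∑ j, u j * v j := Finset.sum_congr rfl fun j _ => mul_comm _ _
    rw [h3, Polynomial.aeval_C, mul_comm]
    congr 1
    have : (algebraMap ℤ (MvPolynomial ι ℝ)) (s.factorial : ℤ)
        = C ((s.factorial : ℝ)) * 1 := by simp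
    rw [this, gaussE_C_mul, gaussE_one, mul_one]
  · rw [mul_comm, hlt hu h, if_neg h.ne']

theorem gaussE_linForm_pow_even {u : ι → ℝ} (hu : ∑ j, u j * u j = 1) (m : ℕ) :
    gaussE (linForm u ^ (2 * m)) = ∏ i ∈ Finset.range m, (2 * (i : ℝ) + 1) := by
  induction m with
  | zero => simp
  | succ m ih =>
    have h : linForm u ^ (2 * (m + 1)) = linForm u * linForm u ^ (2 * m + 1) := by ring
    rw [h, gaussE_linForm_mul, Derivation.leibniz_pow, dirDeriv_linForm, hu, map_one,
      Finset.prod_range_succ, ← ih]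
    simp only [Nat.add_sub_cancel, smul_eq_mul, mul_one, map_nsmul]
    simp
    ring

end AffineImage

/-! ### Averaged likelihood ratios and products of samples -/

section SecondMoment

/-- An averaged Cauchy–Schwarz inequality: if the likelihood ratios `L v` have averaged correlation at
most `A`, then the average over `v` of `E[g L v]` is at most `√(A E[g²])`. -/
theorem sq_integral_integral_mul_le {V Y : Type*} [MeasurableSpace V] [MeasurableSpace Y]
    {σ : Measure V} {ν : Measure Y} [IsProbabilityMeasure σ] [IsProbabilityMeasure ν]
    {L : V → Y → ℝ} (hL : Measurable (Function.uncurry L)) {M : Y → ℝ} (hM : MemLp M 2 ν)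
    (hLM : ∀ v y, |L v y| ≤ M y) {f : Y → ℝ} (hf : MemLp f 2 ν) {A : ℝ}
    (hA : ∫ v, ∫ v', ∫ y, L v y * L v' y ∂ν ∂σ ∂σ ≤ A) :
    (∫ v, ∫ y, f y * L v y ∂ν ∂σ) ^ 2 ≤ (∫ y, f y ^ 2 ∂ν) * A := by
  set J : Y → ℝ := fun y => ∫ v, L v y ∂σ with hJ
  have hJm : StronglyMeasurable J := by
    have h : StronglyMeasurable (fun p : Y × V => L p.2 p.1) :=
      (hL.comp measurable_swap).stronglyMeasurable
    exact h.integral_prod_right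
  have hLv : ∀ v, MemLp (L v) 2 ν := fun v =>
    hM.mono (hL.comp measurable_prodMk_left).aestronglyMeasurable
      (.of_forall fun y => (hLM v y).trans (le_abs_self _))
  have hJ2 : MemLp J 2 ν := by
    refine hM.mono hJm.aestronglyMeasurable (.of_forall fun y => ?_)
    have h : ‖J y‖ ≤ M y * σ.real Set.univ :=
      norm_integral_le_of_norm_le_const (.of_forall fun v => hLM v y)
    simp only [probReal_univ, mul_one] at h
    exact h.trans (le_abs_self _)
  have swap : ∀ g : Y → ℝ, MemLp g 2 ν →
      ∫ v, ∫ y, g y * L v y ∂ν ∂σ = ∫ y, g y * J y ∂ν := by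
    intro g hg
    have hint : Integrable (Function.uncurry fun v y => g y * L v y) (σ.prod ν) := by
      have h1 : Integrable (fun p : V × Y => g p.2 * M p.2) (σ.prod ν) :=
        (hg.integrable_mul hM).comp_snd σ
      refine h1.mono ?_ (.of_forall fun p => ?_)
      · exact (hg.aestronglyMeasurable.comp_snd).mul hL.aestronglyMeasurable
      · change ‖g p.2 * L p.1 p.2‖ ≤ ‖g p.2 * M p.2‖
        rw [norm_mul, norm_mul]
        exact mul_le_mul_of_nonneg_left ((hLM _ _).trans (le_abs_self _)) (norm_nonneg _)
    rw [integral_integral_swap hint]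
    exact integral_congr_ae (.of_forall fun y => integral_const_mul _ _)
  have hJJ : ∫ y, J y ^ 2 ∂ν ≤ A := by
    refine le_of_eq_of_le ?_ hA
    have h1 : ∀ v, ∫ v', ∫ y, L v y * L v' y ∂ν ∂σ = ∫ y, J y * L v y ∂ν := fun v => by
      rw [swap _ (hLv v)]
      exact integral_congr_ae (.of_forall fun y => mul_comm _ _)
    simp_rw [h1]
    rw [swap J hJ2]
    exact integral_congr_ae (.of_forall fun y => sq (J y))
  have hq : ∀ x : ℝ, 0 ≤ (∫ y, f y ^ 2 ∂ν) * (x * x) + (2 * ∫ y, f y * J y ∂ν) * x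
      + ∫ y, J y ^ 2 ∂ν := by
    intro x
    have h1 : 0 ≤ ∫ y, (x * f y + J y) ^ 2 ∂ν := integral_nonneg fun y => sq_nonneg _
    have h2 : ∫ y, (x * f y + J y) ^ 2 ∂ν
        = ∫ y, (x * x * f y ^ 2 + 2 * x * (f y * J y)) + J y ^ 2 ∂ν :=
      integral_congr_ae (.of_forall fun y => by ring)
    have i1 := hf.integrable_sq.const_mul (x * x)
    have i2 : Integrable (fun y => 2 * x * (f y * J y)) ν := (hf.integrable_mul hJ2).const_mul _
    have i3 : ∫ y, (x * x * f y ^ 2 + 2 * x * (f y * J y)) + J y ^ 2 ∂ν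
        = ∫ y, x * x * f y ^ 2 + 2 * x * (f y * J y) ∂ν + ∫ y, J y ^ 2 ∂ν :=
      integral_add (i1.add i2) hJ2.integrable_sq
    rw [h2, i3, integral_add i1 i2, integral_const_mul, integral_const_mul] at h1
    linarith
  have hd := discrim_le_zero hq
  rw [discrim] at hd
  rw [swap f hf]
  have h3 : (∫ y, f y ^ 2 ∂ν) * (∫ y, J y ^ 2 ∂ν) ≤ (∫ y, f y ^ 2 ∂ν) * A :=
    mul_le_mul_of_nonneg_left hJJ (integral_nonneg fun y => sq_nonneg _)
  nlinarith

end SecondMoment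

section Samples

variable {n d : ℕ}

/-- The weight `∏ᵢ (1 + ‖yᵢ‖)`, whose powers dominate all polynomials in the samples. -/
noncomputable def sampleWeight (y : Fin n → EuclideanSpace ℝ (Fin d)) : ℝ := ∏ i, (1 + ‖y i‖)

theorem one_le_sampleWeight (y : Fin n → EuclideanSpace ℝ (Fin d)) : 1 ≤ sampleWeight y :=
  Finset.one_le_prod fun i _ => by linarith [norm_nonneg (y i)]

theorem one_add_norm_le_sampleWeight (y : Fin n → EuclideanSpace ℝ (Fin d)) (i : Fin n) :
    1 + ‖y i‖ ≤ sampleWeight y := by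
  rw [sampleWeight, ← Finset.mul_prod_erase _ _ (Finset.mem_univ i)]
  exact le_mul_of_one_le_right (by positivity)
    (Finset.one_le_prod fun i _ => by linarith [norm_nonneg (y i)])

theorem continuous_evalPoly (f : MvPolynomial (Fin n × Fin d) ℝ) :
    Continuous (evalPoly f) :=
  (MvPolynomial.continuous_eval f).comp (by fun_prop)

theorem exists_abs_evalPoly_le (f : MvPolynomial (Fin n × Fin d) ℝ) :
    ∃ (C : ℝ) (m : ℕ), 0 ≤ C ∧ ∀ y, |evalPoly f y| ≤ C * sampleWeight y ^ m := by
  obtain ⟨C, m, hC, h⟩ := exists_abs_eval_le f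
  refine ⟨C, m, hC, fun y => ?_⟩
  have := h (fun p => y p.1 p.2) (sampleWeight y - 1) (by linarith [one_le_sampleWeight y])
    (fun p => (PiLp.norm_apply_le (y p.1) p.2).trans
      (by linarith [one_add_norm_le_sampleWeight y p.1]))
  rwa [add_sub_cancel] at this

theorem integrable_sampleWeight_pow {μ : Measure (EuclideanSpace ℝ (Fin d))}
    [IsProbabilityMeasure μ] (hμ : ∀ m : ℕ, Integrable (fun y => (1 + ‖y‖) ^ m) μ) (m : ℕ) :
    Integrable (fun y : Fin n → EuclideanSpace ℝ (Fin d) => sampleWeight y ^ m)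
      (Measure.pi fun _ => μ) := by
  have h := Integrable.fintype_prod (f := fun (_ : Fin n) y => (1 + ‖y‖) ^ m)
    (μ := fun _ => μ) fun _ => hμ m
  refine h.congr (.of_forall fun y => ?_)
  exact Finset.prod_pow _ _ _

theorem integral_sampleWeight_pow (μ : Measure (EuclideanSpace ℝ (Fin d)))
    [IsProbabilityMeasure μ] (m : ℕ) :
    ∫ y : Fin n → EuclideanSpace ℝ (Fin d), sampleWeight y ^ m ∂(Measure.pi fun _ => μ)
      = (∫ y, (1 + ‖y‖) ^ m ∂μ) ^ n := by
  have h := integral_fintype_prod_eq_pow (ι := Fin n) (μ := μ) (fun y => (1 + ‖y‖) ^ m)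
  rw [Fintype.card_fin] at h
  rw [← h]
  exact integral_congr_ae (.of_forall fun y => (Finset.prod_pow _ _ _).symm)

theorem integrable_evalPoly {μ : Measure (EuclideanSpace ℝ (Fin d))}
    [IsProbabilityMeasure μ] (hμ : ∀ m : ℕ, Integrable (fun y => (1 + ‖y‖) ^ m) μ)
    (f : MvPolynomial (Fin n × Fin d) ℝ) :
    Integrable (evalPoly f) (Measure.pi fun _ => μ) := by
  obtain ⟨C, m, hC, h⟩ := exists_abs_evalPoly_le f
  exact ((integrable_sampleWeight_pow hμ m).const_mul C).mono'
    (continuous_evalPoly f).aestronglyMeasurable (.of_forall h)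

/-- The exponents of the `i`-th sample in a monomial in all samples. -/
noncomputable def sampleExponent (s : Fin n × Fin d →₀ ℕ) (i : Fin n) : Fin d →₀ ℕ :=
  Finsupp.equivFunOnFinite.symm fun j => s (i, j)

theorem sum_degree_sampleExponent (s : Fin n × Fin d →₀ ℕ) :
    ∑ i, (sampleExponent s i).degree = s.degree := by
  simp [Finsupp.degree_eq_sum, sampleExponent, Fintype.sum_prod_type]

open MvPolynomial in
theorem evalPoly_monomial (s : Fin n × Fin d →₀ ℕ) (c : ℝ)
    (y : Fin n → EuclideanSpace ℝ (Fin d)) :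
    evalPoly (monomial s c) y
      = c * ∏ i, eval (fun j => y i j) (monomial (sampleExponent s i) (1 : ℝ)) := by
  simp [evalPoly, eval_monomial, Finsupp.prod_fintype, sampleExponent, Fintype.prod_prod_type]

/-- The degree patterns `(t₁, …, tₙ)` of total degree at most `D`. -/
def degreePatterns (n D : ℕ) : Finset (Fin n → ℕ) :=
  (Fintype.piFinset fun _ => Finset.range (D + 1)).filter fun t => ∑ i, t i ≤ D

/-- The truncation to degree `D` of the likelihood ratio of `n` samples whose component along `v` has
Hermite moments `lam` and whose other components are standard Gaussian. -/
noncomputable def truncatedLR (lam : ℕ → ℝ) (D : ℕ) (v : Fin d → ℝ)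
    (y : Fin n → EuclideanSpace ℝ (Fin d)) : ℝ :=
  ∑ t ∈ degreePatterns n D, ∏ i, (lam (t i) / (t i).factorial *
    MvPolynomial.eval (fun j => y i j) (hermiteForm v (t i)))

theorem eval_linForm (v : Fin d → ℝ) (y : EuclideanSpace ℝ (Fin d)) :
    MvPolynomial.eval (fun j => y j) (linForm v) = ∑ j, v j * y j := by
  simp [linForm]

theorem eval_hermiteForm (v : Fin d → ℝ) (t : ℕ) (y : EuclideanSpace ℝ (Fin d)) :
    MvPolynomial.eval (fun j => y j) (hermiteForm v t)
      = Polynomial.aeval (∑ j, v j * y j) (Polynomial.hermite t) := by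
  rw [hermiteForm, ← eval_linForm]
  exact (Polynomial.aeval_algHom_apply
    ((MvPolynomial.aeval fun j => y j : MvPolynomial (Fin d) ℝ →ₐ[ℝ] ℝ).restrictScalars ℤ)
    (linForm v) (Polynomial.hermite t)).symm

theorem continuous_truncatedLR (lam : ℕ → ℝ) (D : ℕ) :
    Continuous fun p : EuclideanSpace ℝ (Fin d) × (Fin n → EuclideanSpace ℝ (Fin d)) =>
      truncatedLR lam D p.1 p.2 := by
  simp only [truncatedLR, eval_hermiteForm]
  refine continuous_finsetSum _ fun t _ => continuous_finsetProd _ fun i _ => ?_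
  refine continuous_const.mul ((Polynomial.continuous_aeval _).comp ?_)
  fun_prop

theorem abs_sum_mul_le_norm {v : EuclideanSpace ℝ (Fin d)} (hv : ‖v‖ = 1)
    (y : EuclideanSpace ℝ (Fin d)) : |∑ j, v j * y j| ≤ ‖y‖ := by
  have h := abs_real_inner_le_norm v y
  rw [hv, one_mul] at h
  simpa [PiLp.inner_apply, mul_comm] using h

theorem exists_abs_truncatedLR_le (lam : ℕ → ℝ) (n d D : ℕ) :
    ∃ (C : ℝ) (m : ℕ), ∀ v : EuclideanSpace ℝ (Fin d), ‖v‖ = 1 →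
      ∀ y : Fin n → EuclideanSpace ℝ (Fin d), |truncatedLR lam D v y| ≤ C * sampleWeight y ^ m := by
  have h : ∀ t : ℕ, ∃ (C : ℝ) (m : ℕ), 0 ≤ C ∧ ∀ x : ℝ,
      |Polynomial.aeval x (Polynomial.hermite t)| ≤ C * (1 + |x|) ^ m := by
    intro t
    obtain ⟨C, m, hC, h⟩ := exists_abs_eval_le
      (Polynomial.aeval (MvPolynomial.X ()) (Polynomial.hermite t) : MvPolynomial Unit ℝ)
    refine ⟨C, m, hC, fun x => ?_⟩
    have := h (fun _ => x) |x| (abs_nonneg x) fun _ => le_rfl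
    have h2 := Polynomial.aeval_algHom_apply
      ((MvPolynomial.aeval fun _ => x : MvPolynomial Unit ℝ →ₐ[ℝ] ℝ).restrictScalars ℤ)
      (MvPolynomial.X ()) (Polynomial.hermite t)
    simp only [AlgHom.restrictScalars_apply, MvPolynomial.aeval_X] at h2
    rw [h2]
    exact this
  choose C m hC h using h
  set A : ℝ := ∑ t ∈ Finset.range (D + 1), |lam t / t.factorial| * C t with hA
  set M : ℕ := ∑ t ∈ Finset.range (D + 1), m t with hM
  refine ⟨(degreePatterns n D).card * A ^ n, M, fun v hv y => ?_⟩
  rw [truncatedLR]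
  refine (Finset.abs_sum_le_sum_abs _ _).trans ?_
  rw [mul_assoc, ← nsmul_eq_mul]
  refine Finset.sum_le_card_nsmul _ _ _ fun t ht => ?_
  rw [Finset.abs_prod, sampleWeight, ← Finset.prod_pow]
  have hc : A ^ n = ∏ _i : Fin n, A := by simp
  rw [hc, ← Finset.prod_mul_distrib]
  refine Finset.prod_le_prod (fun i _ => abs_nonneg _) fun i _ => ?_
  have hti : t i ∈ Finset.range (D + 1) :=
    Fintype.mem_piFinset.1 (Finset.mem_filter.1 ht).1 i
  rw [abs_mul, eval_hermiteForm]
  have h1 : (1 : ℝ) ≤ 1 + ‖y i‖ := by linarith [norm_nonneg (y i)]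
  have h2 := Finset.single_le_sum (f := fun t => |lam t / t.factorial| * C t)
    (fun t _ => mul_nonneg (abs_nonneg _) (hC t)) hti
  have h3 : m (t i) ≤ M := Finset.single_le_sum (f := m) (fun t _ => Nat.zero_le _) hti
  calc _ ≤ |lam (t i) / (t i).factorial| * (C (t i) * (1 + ‖y i‖) ^ m (t i)) := by
        refine mul_le_mul_of_nonneg_left ((h _ _).trans ?_) (abs_nonneg _)
        have := hC (t i)
        gcongr
        exact abs_sum_mul_le_norm hv (y i)
    _ = (|lam (t i) / (t i).factorial| * C (t i)) * (1 + ‖y i‖) ^ m (t i) := by ring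
    _ ≤ A * (1 + ‖y i‖) ^ M := by
        refine mul_le_mul h2 (pow_le_pow_right₀ h1 h3) (by positivity) ?_
        exact Finset.sum_nonneg fun t _ => mul_nonneg (abs_nonneg _) (hC t)

theorem integral_prod_eval_stdGaussian (g : Fin n → MvPolynomial (Fin d) ℝ) :
    ∫ y : Fin n → EuclideanSpace ℝ (Fin d), ∏ i, MvPolynomial.eval (fun j => y i j) (g i)
      ∂nullLaw n d = ∏ i, gaussE (g i) :=
  integral_fintype_prod_eq_prod (fun i (x : EuclideanSpace ℝ (Fin d)) =>
    MvPolynomial.eval (fun j => x j) (g i))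

theorem integrable_prod_eval_stdGaussian (g : Fin n → MvPolynomial (Fin d) ℝ) :
    Integrable (fun y : Fin n → EuclideanSpace ℝ (Fin d) =>
      ∏ i, MvPolynomial.eval (fun j => y i j) (g i)) (nullLaw n d) :=
  Integrable.fintype_prod (f := fun i (x : EuclideanSpace ℝ (Fin d)) =>
    MvPolynomial.eval (fun j => x j) (g i)) fun i => integrable_eval_stdGaussian (g i)

instance (n d : ℕ) : IsProbabilityMeasure (nullLaw n d) := by
  unfold nullLaw; infer_instance

open MvPolynomial in
/-- The truncated likelihood ratio represents the expectation of the low-degree polynomials. The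
measure `μ` is any law of one sample whose Hermite expansion along `v` has coefficients `lam`. -/
theorem integral_evalPoly_eq_integral_mul_truncatedLR {μ : Measure (EuclideanSpace ℝ (Fin d))}
    [IsProbabilityMeasure μ] (hμ : ∀ m : ℕ, Integrable (fun y => (1 + ‖y‖) ^ m) μ)
    {lam : ℕ → ℝ} {D : ℕ} {v : Fin d → ℝ} (hv : ∑ j, v j * v j = 1)
    (hexp : ∀ F : MvPolynomial (Fin d) ℝ, F.totalDegree ≤ D → ∫ y, eval (fun j => y j) F ∂μ
      = ∑ t ∈ Finset.range (D + 1), lam t / t.factorial * gaussE ((dirDeriv v)^[t] F))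
    {f : MvPolynomial (Fin n × Fin d) ℝ} (hf : f.totalDegree ≤ D) :
    ∫ y, evalPoly f y ∂(Measure.pi fun _ => μ)
      = ∫ y, evalPoly f y * truncatedLR lam D v y ∂nullLaw n d := by
  have hsum : ∀ y : Fin n → EuclideanSpace ℝ (Fin d),
      evalPoly f y = ∑ s ∈ f.support, evalPoly (monomial s (coeff s f)) y := by
    intro y
    unfold evalPoly
    conv_lhs => rw [f.as_sum]
    rw [map_sum]
  have hterm : ∀ (s : Fin n × Fin d →₀ ℕ) (c : ℝ) (t : Fin n → ℕ)
      (y : Fin n → EuclideanSpace ℝ (Fin d)),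
      evalPoly (monomial s c) y * ∏ i, (lam (t i) / (t i).factorial *
        eval (fun j => y i j) (hermiteForm v (t i)))
      = (c * ∏ i, lam (t i) / (t i).factorial) * ∏ i, eval (fun j => y i j)
        (monomial (sampleExponent s i) (1 : ℝ) * hermiteForm v (t i)) := by
    intro s c t y
    rw [evalPoly_monomial, Finset.prod_mul_distrib]
    simp only [map_mul, Finset.prod_mul_distrib]
    ring
  simp_rw [hsum, Finset.sum_mul]
  rw [integral_finsetSum _ fun s _ => integrable_evalPoly hμ _, integral_finsetSum]
  · refine Finset.sum_congr rfl fun s hs => ?_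
    have hdeg : ∑ i, (sampleExponent s i).degree ≤ D := by
      rw [sum_degree_sampleExponent]; exact (le_totalDegree hs).trans hf
    have hdi : ∀ i, (monomial (sampleExponent s i) (1 : ℝ)).totalDegree
        ≤ (sampleExponent s i).degree := fun i => totalDegree_monomial_le _ _
    simp_rw [truncatedLR, Finset.mul_sum, hterm]
    rw [integral_finsetSum _ fun t _ => (integrable_prod_eval_stdGaussian _).const_mul _]
    simp_rw [integral_const_mul, integral_prod_eval_stdGaussian, evalPoly_monomial]
    rw [integral_const_mul, integral_fintype_prod_eq_prod (fun i (y : EuclideanSpace ℝ (Fin d)) =>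
      eval (fun j => y j) (monomial (sampleExponent s i) (1 : ℝ)))]
    have h1 : ∀ i, ∫ y : EuclideanSpace ℝ (Fin d),
        eval (fun j => y j) (monomial (sampleExponent s i) (1 : ℝ)) ∂μ
        = ∑ t ∈ Finset.range (D + 1), lam t / t.factorial
          * gaussE (monomial (sampleExponent s i) (1 : ℝ) * hermiteForm v t) := by
      intro i
      simp_rw [gaussE_mul_hermiteForm hv]
      exact hexp _ ((hdi i).trans ((Finset.single_le_sum
        (f := fun i => (sampleExponent s i).degree) (fun _ _ => Nat.zero_le _)
        (Finset.mem_univ i)).trans hdeg))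
    simp_rw [h1]
    rw [Finset.prod_univ_sum, Finset.mul_sum]
    symm
    refine Finset.sum_subset_zero_on_sdiff (Finset.filter_subset _ _) (fun t ht => ?_)
      fun t _ => by rw [Finset.prod_mul_distrib, mul_assoc]
    -- A pattern of total degree above `D` exceeds the degree of the monomial in some sample.
    have ht2 : D < ∑ i, t i := by
      rw [Finset.mem_sdiff, degreePatterns, Finset.mem_filter] at ht
      by_contra hcon
      exact ht.2 ⟨ht.1, by omega⟩
    obtain ⟨i, -, hi⟩ : ∃ i ∈ Finset.univ, (sampleExponent s i).degree < t i :=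
      Finset.exists_lt_of_sum_lt (by omega)
    refine mul_eq_zero_of_right _ (Finset.prod_eq_zero (Finset.mem_univ i) ?_)
    rw [gaussE_mul_hermiteForm hv, dirDeriv_iterate_eq_zero v (lt_of_le_of_lt (hdi i) hi),
      map_zero, mul_zero]
  · intro s _
    simp_rw [truncatedLR, Finset.mul_sum, hterm]
    exact integrable_finsetSum _ fun t _ => (integrable_prod_eval_stdGaussian _).const_mul _

/-- The correlation of the truncated likelihood ratios in the directions `u` and `v`. -/
theorem integral_truncatedLR_mul_truncatedLR (lam : ℕ → ℝ) (D : ℕ) {u v : Fin d → ℝ}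
    (hu : ∑ j, u j * u j = 1) (hv : ∑ j, v j * v j = 1) :
    ∫ y, truncatedLR lam D u y * truncatedLR lam D v y ∂nullLaw n d
      = ∑ t ∈ degreePatterns n D,
        (∏ i, lam (t i) ^ 2 / (t i).factorial) * (∑ j, u j * v j) ^ (∑ i, t i) := by
  have hterm : ∀ (s t : Fin n → ℕ) (y : Fin n → EuclideanSpace ℝ (Fin d)),
      (∏ i, (lam (s i) / (s i).factorial * MvPolynomial.eval (fun j => y i j)
        (hermiteForm u (s i)))) * (∏ i, (lam (t i) / (t i).factorial *
        MvPolynomial.eval (fun j => y i j) (hermiteForm v (t i))))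
      = (∏ i, lam (s i) / (s i).factorial * (lam (t i) / (t i).factorial)) *
        ∏ i, MvPolynomial.eval (fun j => y i j) (hermiteForm u (s i) * hermiteForm v (t i)) := by
    intro s t y
    simp only [map_mul, ← Finset.prod_mul_distrib]
    exact Finset.prod_congr rfl fun i _ => by ring
  simp_rw [truncatedLR, Finset.sum_mul_sum, hterm]
  rw [integral_finsetSum _ fun s _ => integrable_finsetSum _ fun t _ =>
    (integrable_prod_eval_stdGaussian _).const_mul _]
  refine Finset.sum_congr rfl fun s hs => ?_
  rw [integral_finsetSum _ fun t _ => (integrable_prod_eval_stdGaussian _).const_mul _]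
  simp_rw [integral_const_mul, integral_prod_eval_stdGaussian,
    gaussE_hermiteForm_mul_hermiteForm hu hv]
  rw [Finset.sum_eq_single s, ← Finset.prod_pow_eq_pow_sum, ← Finset.prod_mul_distrib,
    ← Finset.prod_mul_distrib]
  · refine Finset.prod_congr rfl fun i _ => ?_
    have : ((s i).factorial : ℝ) ≠ 0 := by positivity
    rw [if_pos rfl]
    field_simp
  · intro t _ hts
    obtain ⟨i, hi⟩ := Function.ne_iff.1 hts.symm
    exact mul_eq_zero_of_right _ (Finset.prod_eq_zero (Finset.mem_univ i) (if_neg hi))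
  · exact fun h => absurd hs h

end Samples

/-! ### Moments of the uniform distribution on the sphere -/

section Sphere

variable {d : ℕ}

theorem isProbabilityMeasure_uniformSphere (hd : 1 ≤ d) :
    IsProbabilityMeasure (uniformSphere d) := by
  have : Nonempty (Fin d) := ⟨⟨0, hd⟩⟩
  have h0 : (volume : Measure (EuclideanSpace ℝ (Fin d))).toSphere Set.univ ≠ 0 := by
    rw [Ne, Measure.measure_univ_eq_zero]
    exact Measure.toSphere_ne_zero _
  refine ⟨?_⟩
  rw [uniformSphere, Measure.smul_apply, smul_eq_mul]
  exact ENNReal.inv_mul_cancel h0 (measure_ne_top _ _)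

/-- The action of a linear isometry on the unit sphere. -/
noncomputable def sphereMap (e : EuclideanSpace ℝ (Fin d) ≃ₗᵢ[ℝ] EuclideanSpace ℝ (Fin d)) (v : UnitSphere d) :
    UnitSphere d :=
  ⟨e v, by simp⟩

theorem measurable_sphereMap (e : EuclideanSpace ℝ (Fin d) ≃ₗᵢ[ℝ] EuclideanSpace ℝ (Fin d)) :
    Measurable (sphereMap e) :=
  (e.continuous.measurable.comp measurable_subtype_coe).subtype_mk

open scoped Pointwise in
theorem measurePreserving_sphereMap
    (e : EuclideanSpace ℝ (Fin d) ≃ₗᵢ[ℝ] EuclideanSpace ℝ (Fin d)) :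
    MeasurePreserving (sphereMap e) (uniformSphere d) (uniformSphere d) := by
  refine ⟨measurable_sphereMap e, ?_⟩
  rw [uniformSphere, Measure.map_smul]
  congr 1
  refine Measure.ext fun s hs => ?_
  rw [Measure.map_apply (measurable_sphereMap e) hs, Measure.toSphere_apply' _ hs,
    Measure.toSphere_apply' _ (measurable_sphereMap e hs)]
  congr 1
  have h : Set.Ioo (0 : ℝ) 1 • ((↑) '' (sphereMap e ⁻¹' s) : Set (EuclideanSpace ℝ (Fin d)))
      = e ⁻¹' (Set.Ioo (0 : ℝ) 1 • ((↑) '' s)) := by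
    ext x
    simp only [Set.mem_smul, Set.mem_image, Set.mem_preimage]
    constructor
    · rintro ⟨r, hr, _, ⟨v, hv, rfl⟩, rfl⟩
      exact ⟨r, hr, _, ⟨_, hv, rfl⟩, by simp [sphereMap]⟩
    · rintro ⟨r, hr, _, ⟨v, hv, rfl⟩, hx⟩
      refine ⟨r, hr, _, ⟨sphereMap e.symm v, ?_, rfl⟩, ?_⟩
      · have : sphereMap e (sphereMap e.symm v) = v := by
          ext1; simp [sphereMap]
        rwa [this]
      · apply e.injective
        rw [← hx]
        simp [sphereMap]
  rw [h]
  exact (e.measurePreserving).measure_preimage_equiv (f := e.toMeasurableEquiv) _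

theorem sum_mul_eq_inner (v y : EuclideanSpace ℝ (Fin d)) :
    ∑ j, v j * y j = inner ℝ v y := by
  simp [PiLp.inner_apply, mul_comm]

theorem sum_mul_self_eq_one (v : UnitSphere d) :
    ∑ j, (v : EuclideanSpace ℝ (Fin d)) j * (v : EuclideanSpace ℝ (Fin d)) j = 1 := by
  rw [sum_mul_eq_inner, real_inner_self_eq_norm_sq, norm_eq_of_mem_sphere, one_pow]

theorem integral_inner_pow_uniformSphere_eq (k : ℕ) (u w : UnitSphere d) :
    ∫ v : UnitSphere d, inner ℝ (v : EuclideanSpace ℝ (Fin d)) (u : EuclideanSpace ℝ (Fin d)) ^ k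
      ∂uniformSphere d
    = ∫ v : UnitSphere d, inner ℝ (v : EuclideanSpace ℝ (Fin d)) (w : EuclideanSpace ℝ (Fin d)) ^ k
      ∂uniformSphere d := by
  set e := (ℝ ∙ ((w : EuclideanSpace ℝ (Fin d)) - u))ᗮ.reflection with he
  have heu : e w = (u : EuclideanSpace ℝ (Fin d)) :=
    Submodule.reflection_sub (by rw [norm_eq_of_mem_sphere, norm_eq_of_mem_sphere])
  have hm := measurePreserving_sphereMap e
  have h := integral_map (μ := uniformSphere d) (φ := sphereMap e)
    (measurable_sphereMap e).aemeasurable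
    (f := fun v : UnitSphere d => inner ℝ (v : EuclideanSpace ℝ (Fin d))
      (u : EuclideanSpace ℝ (Fin d)) ^ k) (Continuous.aestronglyMeasurable (by fun_prop))
  rw [hm.map_eq] at h
  rw [h]
  refine integral_congr_ae (.of_forall fun v => ?_)
  simp only [sphereMap, ← heu, e.inner_map_map]

open MvPolynomial in
theorem natCast_pow_le_integral_norm_pow (d m : ℕ) :
    (d : ℝ) ^ m ≤ ∫ y, ‖y‖ ^ (2 * m) ∂stdGaussian (EuclideanSpace ℝ (Fin d)) := by
  rcases Nat.eq_zero_or_pos d with rfl | hd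
  · rcases Nat.eq_zero_or_pos m with rfl | hm
    · simp
    · rw [Nat.cast_zero, zero_pow hm.ne']
      exact integral_nonneg fun y => by positivity
  have hsq : ∀ y : EuclideanSpace ℝ (Fin d),
      ‖y‖ ^ 2 = eval (fun j => y j) (∑ j, X j * X j : MvPolynomial (Fin d) ℝ) := by
    intro y
    rw [← real_inner_self_eq_norm_sq, ← sum_mul_eq_inner]
    simp
  have h2 : ∫ y, ‖y‖ ^ 2 ∂stdGaussian (EuclideanSpace ℝ (Fin d)) = d := by
    simp_rw [hsq]
    rw [← gaussE_apply, map_sum]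
    simp [gaussE_X_mul]
  have hint : ∀ k, Integrable (fun y => (‖y‖ ^ 2) ^ k)
      (stdGaussian (EuclideanSpace ℝ (Fin d))) := by
    intro k
    simp_rw [hsq, ← map_pow]
    exact integrable_eval_stdGaussian _
  have hi1 := hint 1
  simp only [pow_one] at hi1
  -- Jensen's inequality, through the tangent line of `x ^ m` at `x = d`.
  have hd' : (0 : ℝ) < d := by exact_mod_cast hd
  have htan : ∀ y : EuclideanSpace ℝ (Fin d),
      (d : ℝ) ^ m * (1 + m * (‖y‖ ^ 2 / d - 1)) ≤ (‖y‖ ^ 2) ^ m := by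
    intro y
    have h := one_add_mul_le_pow (a := ‖y‖ ^ 2 / d - 1) (by
      have : 0 ≤ ‖y‖ ^ 2 / (d : ℝ) := by positivity
      linarith) m
    calc _ ≤ (d : ℝ) ^ m * (1 + (‖y‖ ^ 2 / d - 1)) ^ m := by gcongr
      _ = _ := by
        rw [← mul_pow]
        congr 1
        field_simp
        ring
  have iq : Integrable (fun y : EuclideanSpace ℝ (Fin d) => (m : ℝ) * (‖y‖ ^ 2 / d - 1))
      (stdGaussian (EuclideanSpace ℝ (Fin d))) :=
    ((hi1.div_const _).sub (integrable_const (1 : ℝ))).const_mul _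
  have hq : ∫ y, (m : ℝ) * (‖y‖ ^ 2 / d - 1) ∂stdGaussian (EuclideanSpace ℝ (Fin d)) = 0 := by
    rw [integral_const_mul, integral_sub (hi1.div_const _) (integrable_const _), integral_div, h2]
    simp [hd'.ne']
  have hl := integral_mono (((integrable_const (1 : ℝ)).add iq).const_mul ((d : ℝ) ^ m))
    (hint m) htan
  simp_rw [← pow_mul] at hl
  refine le_of_eq_of_le ?_ hl
  have h1 := integral_add (integrable_const (1 : ℝ)) iq
  rw [hq] at h1
  simp only [integral_const, probReal_univ, smul_eq_mul, mul_one, add_zero] at h1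
  rw [integral_const_mul]
  exact (by rw [h1, mul_one] : (d : ℝ) ^ m = (d : ℝ) ^ m * ∫ y : EuclideanSpace ℝ (Fin d),
    1 + (m : ℝ) * (‖y‖ ^ 2 / d - 1) ∂stdGaussian (EuclideanSpace ℝ (Fin d)))

/-- The even moments of a coordinate of a uniform point of the sphere. They are compared with those
of a standard Gaussian vector `y`: by rotation invariance, the average of `⟨v, y⟩ ^ (2 m)` over the
sphere is a constant multiple of `‖y‖ ^ (2 m)`. -/
theorem integral_inner_pow_even_mul_le (hd : 1 ≤ d) (m : ℕ) (u : UnitSphere d) :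
    (∫ v : UnitSphere d, inner ℝ (v : EuclideanSpace ℝ (Fin d)) (u : EuclideanSpace ℝ (Fin d))
      ^ (2 * m) ∂uniformSphere d) * (d : ℝ) ^ m ≤ ∏ i ∈ Finset.range m, (2 * (i : ℝ) + 1) := by
  have := isProbabilityMeasure_uniformSphere hd
  set I := ∫ v : UnitSphere d, inner ℝ (v : EuclideanSpace ℝ (Fin d))
    (u : EuclideanSpace ℝ (Fin d)) ^ (2 * m) ∂uniformSphere d with hI
  have hI0 : 0 ≤ I := integral_nonneg fun v => by rw [pow_mul]; positivity
  have hy : ∀ y : EuclideanSpace ℝ (Fin d), ∫ v : UnitSphere d,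
      inner ℝ (v : EuclideanSpace ℝ (Fin d)) y ^ (2 * m) ∂uniformSphere d = ‖y‖ ^ (2 * m) * I := by
    intro y
    obtain ⟨w, hw⟩ : ∃ w : UnitSphere d, y = ‖y‖ • (w : EuclideanSpace ℝ (Fin d)) := by
      by_cases h : y = 0
      · exact ⟨u, by simp [h]⟩
      · refine ⟨⟨‖y‖⁻¹ • y, by simp [norm_smul, h]⟩, ?_⟩
        rw [smul_smul, mul_inv_cancel₀ (norm_ne_zero_iff.2 h), one_smul]
    rw [hI, integral_inner_pow_uniformSphere_eq _ u w, ← integral_const_mul]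
    refine integral_congr_ae (.of_forall fun v => ?_)
    simp only
    conv_lhs => rw [hw]
    rw [real_inner_smul_right, mul_pow]
  have hint : Integrable (Function.uncurry fun (v : UnitSphere d) (y : EuclideanSpace ℝ (Fin d)) =>
      inner ℝ (v : EuclideanSpace ℝ (Fin d)) y ^ (2 * m))
      ((uniformSphere d).prod (stdGaussian (EuclideanSpace ℝ (Fin d)))) := by
    refine ((integrable_one_add_norm_pow_stdGaussian (2 * m)).comp_snd (uniformSphere d)).mono'
      (Continuous.aestronglyMeasurable (by fun_prop)) (.of_forall fun p => ?_)
    change ‖inner ℝ (p.1 : EuclideanSpace ℝ (Fin d)) p.2 ^ (2 * m)‖ ≤ _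
    rw [norm_pow]
    refine pow_le_pow_left₀ (norm_nonneg _) ?_ _
    have := norm_inner_le_norm (𝕜 := ℝ) (p.1 : EuclideanSpace ℝ (Fin d)) p.2
    rw [norm_eq_of_mem_sphere, one_mul] at this
    linarith
  have hswap := integral_integral_swap hint
  have hG : ∀ v : UnitSphere d, ∫ y, inner ℝ (v : EuclideanSpace ℝ (Fin d)) y ^ (2 * m)
      ∂stdGaussian (EuclideanSpace ℝ (Fin d)) = ∏ i ∈ Finset.range m, (2 * (i : ℝ) + 1) := by
    intro v
    rw [← gaussE_linForm_pow_even (sum_mul_self_eq_one v), gaussE_apply]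
    refine integral_congr_ae (.of_forall fun y => ?_)
    simp only [map_pow, eval_linForm, sum_mul_eq_inner]
  simp_rw [hG, hy] at hswap
  rw [integral_const, integral_mul_const] at hswap
  simp only [probReal_univ, one_smul] at hswap
  rw [hswap, mul_comm]
  exact mul_le_mul_of_nonneg_right (natCast_pow_le_integral_norm_pow d m) hI0

theorem integral_inner_pow_le (hd : 1 ≤ d) {D m : ℕ} (hm : m ≤ D) {r : ℝ} (hr : 0 ≤ r)
    (hrD : 2 * (D : ℝ) ≤ r ^ 2 * d) (u : UnitSphere d) :
    ∫ v : UnitSphere d, inner ℝ (v : EuclideanSpace ℝ (Fin d)) (u : EuclideanSpace ℝ (Fin d)) ^ m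
      ∂uniformSphere d ≤ r ^ m := by
  have := isProbabilityMeasure_uniformSphere hd
  have hd' : (0 : ℝ) < d := by exact_mod_cast hd
  set ρ : UnitSphere d → ℝ := fun v =>
    inner ℝ (v : EuclideanSpace ℝ (Fin d)) (u : EuclideanSpace ℝ (Fin d)) with hρ
  have hint : ∀ k : ℕ, Integrable (fun v => ρ v ^ k) (uniformSphere d) := by
    intro k
    refine (integrable_const (1 : ℝ)).mono' (Continuous.aestronglyMeasurable (by fun_prop))
      (.of_forall fun v => ?_)
    rw [norm_pow]
    refine pow_le_one₀ (norm_nonneg _) ?_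
    have := norm_inner_le_norm (𝕜 := ℝ) (v : EuclideanSpace ℝ (Fin d)) u
    rwa [norm_eq_of_mem_sphere, norm_eq_of_mem_sphere, one_mul] at this
  have h2 : ∫ v, ρ v ^ (2 * m) ∂uniformSphere d ≤ (r ^ m) ^ 2 := by
    have h := integral_inner_pow_even_mul_le hd m u
    have hp : ∏ i ∈ Finset.range m, (2 * (i : ℝ) + 1) ≤ (2 * (D : ℝ)) ^ m := by
      rw [← Finset.card_range m, ← Finset.prod_const, Finset.card_range]
      refine Finset.prod_le_prod (fun i _ => by positivity) fun i hi => ?_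
      have : (i : ℝ) + 1 ≤ D := by
        exact_mod_cast (Finset.mem_range.1 hi).trans_le hm
      linarith
    have h3 : (2 * (D : ℝ)) ^ m ≤ (r ^ 2 * d) ^ m := by gcongr
    rw [mul_pow (r ^ 2)] at h3
    have h4 := le_of_mul_le_mul_right ((h.trans hp).trans h3) (pow_pos hd' m)
    rwa [← pow_mul, mul_comm m 2, pow_mul]
  have h3 : (∫ v, ρ v ^ m ∂uniformSphere d) ^ 2 ≤ ∫ v, ρ v ^ (2 * m) ∂uniformSphere d := by
    set c := ∫ v, ρ v ^ m ∂uniformSphere d with hc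
    have h0 : 0 ≤ ∫ v, (ρ v ^ m - c) ^ 2 ∂uniformSphere d := integral_nonneg fun v => sq_nonneg _
    have h1 : ∫ v, (ρ v ^ m - c) ^ 2 ∂uniformSphere d
        = ∫ v, (ρ v ^ (2 * m) - 2 * c * ρ v ^ m) + c ^ 2 ∂uniformSphere d :=
      integral_congr_ae (.of_forall fun v => by ring)
    have i3 : ∫ v, (ρ v ^ (2 * m) - 2 * c * ρ v ^ m) + c ^ 2 ∂uniformSphere d
        = ∫ v, ρ v ^ (2 * m) - 2 * c * ρ v ^ m ∂uniformSphere d + c ^ 2 := by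
      have := integral_add ((hint (2 * m)).sub ((hint m).const_mul (2 * c)))
        (integrable_const (c ^ 2))
      simpa using this
    rw [h1, i3, integral_sub (hint _) ((hint m).const_mul _), integral_const_mul, ← hc] at h0
    nlinarith
  exact (le_abs_self _).trans (abs_le_of_sq_le_sq (h3.trans h2) (by positivity))
end Sphere

/-! ### Low-degree advantage of a mixture along a random direction -/

section Mixture

variable {d : ℕ}

/-- For a unit vector `v`, this map replaces the component `⟨v, y⟩` of `y` by `a + b⟨v, y⟩` and leaves
the orthogonal complement of `v` alone. -/
noncomputable def affineMap (a b : ℝ) (v y : EuclideanSpace ℝ (Fin d)) :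
    EuclideanSpace ℝ (Fin d) :=
  y + (a + (b - 1) * inner ℝ v y) • v

/-- The mixture, with weights `w c`, of the distributions that are `N(a c, (b c)²)` along `v` and
standard Gaussian on the orthogonal complement of `v`. -/
noncomputable def affineMixture {κ : Type*} [Fintype κ] (w a b : κ → ℝ)
    (v : EuclideanSpace ℝ (Fin d)) : Measure (EuclideanSpace ℝ (Fin d)) :=
  ∑ c, ENNReal.ofReal (w c) •
    (stdGaussian (EuclideanSpace ℝ (Fin d))).map (affineMap (a c) (b c) v)

theorem continuous_affineMap (a b : ℝ) :
    Continuous fun p : EuclideanSpace ℝ (Fin d) × EuclideanSpace ℝ (Fin d) =>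
      affineMap a b p.1 p.2 := by
  unfold affineMap; fun_prop

theorem measurable_affineMap (a b : ℝ) (v : EuclideanSpace ℝ (Fin d)) :
    Measurable (affineMap a b v) :=
  ((continuous_affineMap a b).comp (Continuous.prodMk_right v)).measurable

theorem eval_affineSubst (a b : ℝ) (v y : EuclideanSpace ℝ (Fin d))
    (F : MvPolynomial (Fin d) ℝ) :
    MvPolynomial.eval (fun j => y j) (affineSubst a b v F)
      = MvPolynomial.eval (fun j => affineMap a b v y j) F := by
  induction F using MvPolynomial.induction_on with
  | C c => simp [affineSubst, MvPolynomial.algebraMap_eq]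
  | add p q hp hq => simp only [map_add, hp, hq]
  | mul_X p j hp =>
    rw [map_mul, map_mul, hp, map_mul, MvPolynomial.eval_X]
    congr 1
    simp only [affineSubst, MvPolynomial.aeval_X, map_add, map_mul, MvPolynomial.eval_X,
      MvPolynomial.eval_C, eval_linForm, sum_mul_eq_inner, affineMap, PiLp.add_apply,
      PiLp.smul_apply, smul_eq_mul]
    ring

theorem one_add_norm_affineMap_le (a b : ℝ) {v : EuclideanSpace ℝ (Fin d)} (hv : ‖v‖ = 1)
    (y : EuclideanSpace ℝ (Fin d)) :
    1 + ‖affineMap a b v y‖ ≤ (2 + |a| + |b - 1|) * (1 + ‖y‖) := by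
  have h1 : ‖affineMap a b v y‖ ≤ ‖y‖ + (|a| + |b - 1| * ‖y‖) := by
    refine (norm_add_le _ _).trans (add_le_add_right ?_ _)
    rw [norm_smul, hv, mul_one, Real.norm_eq_abs]
    refine (abs_add_le _ _).trans (add_le_add_right ?_ _)
    rw [abs_mul]
    have := abs_real_inner_le_norm v y
    rw [hv, one_mul] at this
    gcongr
  have h2 : 0 ≤ |a| * ‖y‖ := by positivity
  have h3 := norm_nonneg y
  have h4 := abs_nonneg (b - 1)
  nlinarith

variable {κ : Type*} {w a b : κ → ℝ}

theorem integrable_affineMixture {g : EuclideanSpace ℝ (Fin d) → ℝ} (hg : Continuous g)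
    {v : EuclideanSpace ℝ (Fin d)} (hint : ∀ c, Integrable
      (fun y => g (affineMap (a c) (b c) v y)) (stdGaussian (EuclideanSpace ℝ (Fin d)))) (c : κ) :
    Integrable g (ENNReal.ofReal (w c) •
      (stdGaussian (EuclideanSpace ℝ (Fin d))).map (affineMap (a c) (b c) v)) :=
  ((integrable_map_measure hg.aestronglyMeasurable
    (measurable_affineMap _ _ _).aemeasurable).2 (hint c)).smul_measure ENNReal.ofReal_ne_top

variable [Fintype κ]

theorem isProbabilityMeasure_affineMixture (hw : ∀ c, 0 ≤ w c) (hw1 : ∑ c, w c = 1)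
    (v : EuclideanSpace ℝ (Fin d)) : IsProbabilityMeasure (affineMixture w a b v) := by
  refine ⟨?_⟩
  have h : ∀ c, (stdGaussian (EuclideanSpace ℝ (Fin d))).map (affineMap (a c) (b c) v) Set.univ
      = 1 := fun c => by
    rw [Measure.map_apply (measurable_affineMap _ _ _) .univ, Set.preimage_univ, measure_univ]
  simp only [affineMixture, Measure.coe_finsetSum, Finset.sum_apply, Measure.smul_apply, h,
    smul_eq_mul, mul_one]
  rw [← ENNReal.ofReal_sum_of_nonneg fun c _ => hw c, hw1, ENNReal.ofReal_one]

theorem measurable_affineMixture (w a b : κ → ℝ) :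
    Measurable fun v : EuclideanSpace ℝ (Fin d) => affineMixture w a b v := by
  have h : ∀ c, Measurable fun v : EuclideanSpace ℝ (Fin d) =>
      (stdGaussian (EuclideanSpace ℝ (Fin d))).map (affineMap (a c) (b c) v) := by
    intro c
    have h1 := (Measure.measurable_map _ (continuous_affineMap (d := d) (a c) (b c)).measurable).comp
      (Measurable.map_prodMk_left (ν := stdGaussian (EuclideanSpace ℝ (Fin d))))
    convert! h1 using 2 with v
    exact (Measure.map_map (continuous_affineMap (a c) (b c)).measurable
      measurable_prodMk_left).symm
  refine Measure.measurable_of_measurable_coe _ fun s hs => ?_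
  simp only [affineMixture, Measure.coe_finsetSum, Finset.sum_apply, Measure.smul_apply,
    smul_eq_mul]
  exact Finset.measurable_fun_sum _ fun c _ =>
    ((Measure.measurable_coe hs).comp (h c)).const_mul _

theorem integral_affineMixture (hw : ∀ c, 0 ≤ w c) {g : EuclideanSpace ℝ (Fin d) → ℝ}
    (hg : Continuous g) {v : EuclideanSpace ℝ (Fin d)} (hint : ∀ c, Integrable
      (fun y => g (affineMap (a c) (b c) v y)) (stdGaussian (EuclideanSpace ℝ (Fin d)))) :
    ∫ y, g y ∂affineMixture w a b v
      = ∑ c, w c * ∫ y, g (affineMap (a c) (b c) v y)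
          ∂stdGaussian (EuclideanSpace ℝ (Fin d)) := by
  rw [affineMixture, integral_finsetSum_measure fun c _ => integrable_affineMixture hg hint c]
  refine Finset.sum_congr rfl fun c _ => ?_
  rw [integral_smul_measure, ENNReal.toReal_ofReal (hw c), smul_eq_mul,
    integral_map (measurable_affineMap _ _ _).aemeasurable hg.aestronglyMeasurable]

theorem integrable_one_add_norm_affineMap_pow {a b : ℝ} {v : EuclideanSpace ℝ (Fin d)}
    (hv : ‖v‖ = 1) (m : ℕ) : Integrable (fun y => (1 + ‖affineMap a b v y‖) ^ m)
      (stdGaussian (EuclideanSpace ℝ (Fin d))) := by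
  refine ((integrable_one_add_norm_pow_stdGaussian m).const_mul
    ((2 + |a| + |b - 1|) ^ m)).mono' ?_ (.of_forall fun y => ?_)
  · exact ((measurable_affineMap a b v).norm.const_add 1).pow_const m |>.aestronglyMeasurable
  · rw [← mul_pow, norm_pow, Real.norm_of_nonneg (by positivity)]
    exact pow_le_pow_left₀ (by positivity) (one_add_norm_affineMap_le a b hv y) m

theorem integrable_one_add_norm_pow_affineMixture {v : EuclideanSpace ℝ (Fin d)}
    (hv : ‖v‖ = 1) (m : ℕ) : Integrable (fun y => (1 + ‖y‖) ^ m) (affineMixture w a b v) :=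
  integrable_finsetSum_measure.2 fun c _ => integrable_affineMixture (by fun_prop)
    (fun _ => integrable_one_add_norm_affineMap_pow hv m) c

/-- The moments of the mixtures are bounded uniformly in the direction `v`. -/
theorem exists_integral_affineMixture_le (hw : ∀ c, 0 ≤ w c) (m : ℕ) :
    ∃ B : ℝ, ∀ v : EuclideanSpace ℝ (Fin d), ‖v‖ = 1 →
      ∫ y, (1 + ‖y‖) ^ m ∂affineMixture w a b v ≤ B := by
  refine ⟨∑ c, w c * ((2 + |a c| + |b c - 1|) ^ m * ∫ y, (1 + ‖y‖) ^ m
    ∂stdGaussian (EuclideanSpace ℝ (Fin d))), fun v hv => ?_⟩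
  rw [integral_affineMixture hw (by fun_prop)
    fun _ => integrable_one_add_norm_affineMap_pow hv m]
  refine Finset.sum_le_sum fun c _ => mul_le_mul_of_nonneg_left ?_ (hw c)
  rw [← integral_const_mul]
  refine integral_mono (integrable_one_add_norm_affineMap_pow hv m)
    ((integrable_one_add_norm_pow_stdGaussian m).const_mul _) fun y => ?_
  simp only
  rw [← mul_pow]
  exact pow_le_pow_left₀ (by positivity) (one_add_norm_affineMap_le _ _ hv y) m

/-- The Hermite moments `E[He_t(x)]` of the one-dimensional mixture of the laws
`N(a c, (b c)²)` with weights `w c`. -/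
noncomputable def mixtureMoment (w a b : κ → ℝ) (t : ℕ) : ℝ :=
  ∑ c, w c * hermiteMoment (a c) (b c) t

theorem integral_eval_affineMixture (hw : ∀ c, 0 ≤ w c) {v : EuclideanSpace ℝ (Fin d)}
    (hv : ∑ j, v j * v j = 1) {D : ℕ} (F : MvPolynomial (Fin d) ℝ) (hF : F.totalDegree ≤ D) :
    ∫ y, MvPolynomial.eval (fun j => y j) F ∂affineMixture w a b v
      = ∑ t ∈ Finset.range (D + 1),
        mixtureMoment w a b t / t.factorial * gaussE ((dirDeriv v)^[t] F) := by
  have hint : ∀ c, Integrable (fun y => MvPolynomial.eval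
      (fun j => affineMap (a c) (b c) v y j) F) (stdGaussian (EuclideanSpace ℝ (Fin d))) := by
    intro c
    simp_rw [← eval_affineSubst]
    exact integrable_eval_stdGaussian _
  rw [integral_affineMixture hw (continuous_eval_euclidean F) hint]
  simp_rw [← eval_affineSubst, ← gaussE_apply]
  rw [Finset.sum_congr rfl fun c _ => by
    rw [gaussE_affineSubst (a c) (b c) hv (D + 1) F (by omega), Finset.mul_sum],
    Finset.sum_comm]
  refine Finset.sum_congr rfl fun t _ => ?_
  rw [mixtureMoment, Finset.sum_div, Finset.sum_mul]
  exact Finset.sum_congr rfl fun c _ => by ring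

theorem measurable_pi_const {α β : Type*} [MeasurableSpace α] [MeasurableSpace β] (n : ℕ)
    {μ : α → Measure β} [∀ x, IsProbabilityMeasure (μ x)] (hμ : Measurable μ) :
    Measurable fun x => Measure.pi fun _ : Fin n => μ x := by
  refine .measure_of_isPiSystem_of_isProbabilityMeasure generateFrom_pi.symm isPiSystem_pi ?_
  rintro _ ⟨s, hs, rfl⟩
  simp only [Measure.pi_pi]
  refine Finset.measurable_fun_prod _ fun i _ => ?_
  exact (Measure.measurable_coe (hs i (Set.mem_univ i))).comp hμ

end Mixture

section Advantage

variable {d n : ℕ} {η α : ℝ} {κ : Type*} [Fintype κ] {w a b : κ → ℝ}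

/-- The law of `n` samples given the direction, as a Markov kernel. -/
noncomputable def mixtureKernel (n : ℕ) (hw : ∀ c, 0 ≤ w c) (hw1 : ∑ c, w c = 1) (a b : κ → ℝ) :
    Kernel (UnitSphere d) (Fin n → EuclideanSpace ℝ (Fin d)) where
  toFun v := Measure.pi fun _ => affineMixture w a b v
  measurable' := by
    have := fun v : UnitSphere d =>
      isProbabilityMeasure_affineMixture (a := a) (b := b) hw hw1 (v : EuclideanSpace ℝ (Fin d))
    exact measurable_pi_const n ((measurable_affineMixture w a b).comp measurable_subtype_coe)

theorem mixtureKernel_apply (n : ℕ) (hw : ∀ c, 0 ≤ w c) (hw1 : ∑ c, w c = 1) (a b : κ → ℝ)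
    (v : UnitSphere d) :
    mixtureKernel n hw hw1 a b v = Measure.pi fun _ => affineMixture w a b v := rfl

theorem altLaw_eq_comp (I : MeanTestingInstance d η α) (hw : ∀ c, 0 ≤ w c) (hw1 : ∑ c, w c = 1)
    (hI : ∀ v : UnitSphere d, I.sample v = affineMixture w a b v) (n : ℕ) :
    I.altLaw n = mixtureKernel n hw hw1 a b ∘ₘ uniformSphere d := by
  rw [MeanTestingInstance.altLaw]
  simp_rw [hI]
  rfl

theorem integral_norm_evalPoly_le {μ : Measure (EuclideanSpace ℝ (Fin d))}
    [IsProbabilityMeasure μ] (hμ : ∀ m : ℕ, Integrable (fun y => (1 + ‖y‖) ^ m) μ)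
    {f : MvPolynomial (Fin n × Fin d) ℝ} {C B : ℝ} {m : ℕ} (hC : 0 ≤ C)
    (hf : ∀ y, |evalPoly f y| ≤ C * sampleWeight y ^ m) (hB : ∫ y, (1 + ‖y‖) ^ m ∂μ ≤ B) :
    ∫ y, ‖evalPoly f y‖ ∂(Measure.pi fun _ => μ) ≤ C * B ^ n := by
  have h1 : ∫ y, ‖evalPoly f y‖ ∂(Measure.pi fun _ => μ)
      ≤ ∫ y : Fin n → EuclideanSpace ℝ (Fin d), C * sampleWeight y ^ m
        ∂(Measure.pi fun _ => μ) :=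
    integral_mono (integrable_evalPoly hμ f).norm
      ((integrable_sampleWeight_pow hμ m).const_mul C) hf
  rw [integral_const_mul, integral_sampleWeight_pow] at h1
  refine h1.trans (mul_le_mul_of_nonneg_left ?_ hC)
  exact pow_le_pow_left₀ (integral_nonneg fun y => by positivity) hB n

theorem integrable_evalPoly_altLaw (hd : 1 ≤ d) (I : MeanTestingInstance d η α)
    (hw : ∀ c, 0 ≤ w c) (hw1 : ∑ c, w c = 1)
    (hI : ∀ v : UnitSphere d, I.sample v = affineMixture w a b v)
    (f : MvPolynomial (Fin n × Fin d) ℝ) : Integrable (evalPoly f) (I.altLaw n) := by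
  have := isProbabilityMeasure_uniformSphere hd
  have hp := fun v : UnitSphere d =>
    isProbabilityMeasure_affineMixture (a := a) (b := b) hw hw1 (v : EuclideanSpace ℝ (Fin d))
  have hfi : ∀ v : UnitSphere d,
      Integrable (evalPoly f) (mixtureKernel n hw hw1 a b v) := fun v =>
    integrable_evalPoly (fun m => integrable_one_add_norm_pow_affineMixture
      (norm_eq_of_mem_sphere v) m) f
  rw [altLaw_eq_comp I hw hw1 hI, Measure.integrable_comp_iff
    (continuous_evalPoly f).aestronglyMeasurable]
  refine ⟨.of_forall hfi, ?_⟩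
  obtain ⟨C, m, hC, hf⟩ := exists_abs_evalPoly_le f
  obtain ⟨B, hB⟩ := exists_integral_affineMixture_le (d := d) (a := a) (b := b) hw m
  refine (integrable_const (C * B ^ n)).mono' ?_ (.of_forall fun v => ?_)
  · exact ((continuous_evalPoly f).norm.stronglyMeasurable.integral_kernel
      (κ := mixtureKernel n hw hw1 a b)).aestronglyMeasurable
  · have hv := norm_eq_of_mem_sphere v
    have hi := fun m => integrable_one_add_norm_pow_affineMixture (w := w) (a := a) (b := b) hv m
    rw [Real.norm_of_nonneg (integral_nonneg fun y => norm_nonneg _), mixtureKernel_apply]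
    exact integral_norm_evalPoly_le hi hC hf (hB v hv)

theorem measurable_uncurry_truncatedLR (lam : ℕ → ℝ) (n d D : ℕ) :
    Measurable (Function.uncurry fun (v : UnitSphere d)
      (y : Fin n → EuclideanSpace ℝ (Fin d)) =>
        truncatedLR lam D (v : EuclideanSpace ℝ (Fin d)) y) := by
  have h1 := (continuous_truncatedLR (n := n) (d := d) lam D).measurable
  have h2 : Measurable fun p : UnitSphere d × (Fin n → EuclideanSpace ℝ (Fin d)) =>
      ((p.1 : EuclideanSpace ℝ (Fin d)), p.2) :=
    (measurable_subtype_coe.comp measurable_fst).prodMk measurable_snd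
  have h3 := Measurable.comp h1 h2
  convert! h3

/-- The low-degree advantage is controlled by the weighted sum of the squares of the Hermite
coefficients, where `r ^ m` bounds the `m`-th moment of the overlap of two random directions. -/
theorem degreeAdvantage_le (hd : 1 ≤ d) (I : MeanTestingInstance d η α)
    (hw : ∀ c, 0 ≤ w c) (hw1 : ∑ c, w c = 1)
    (hI : ∀ v : UnitSphere d, I.sample v = affineMixture w a b v)
    {D : ℕ} {r C : ℝ} (hr : 0 ≤ r) (hrD : 2 * (D : ℝ) ≤ r ^ 2 * d) (hC : 0 ≤ C)
    (hlam : (∑ t ∈ Finset.range (D + 1), mixtureMoment w a b t ^ 2 / t.factorial * r ^ t) ^ n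
      ≤ C ^ 2) :
    degreeAdvantage D (nullLaw n d) (I.altLaw n) ≤ (C : EReal) := by
  have := isProbabilityMeasure_uniformSphere hd
  have hp := fun v : UnitSphere d =>
    isProbabilityMeasure_affineMixture (a := a) (b := b) hw hw1 (v : EuclideanSpace ℝ (Fin d))
  set lam := mixtureMoment w a b with hlam_def
  refine iSup_le fun f => iSup_le fun hf => iSup_le fun hpos => ?_
  rw [EReal.coe_le_coe_iff, div_le_iff₀ (Real.sqrt_pos.2 hpos)]
  have hmean : ∫ y, evalPoly f y ∂I.altLaw n
      = ∫ v : UnitSphere d, ∫ y, evalPoly f y * truncatedLR lam D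
        (v : EuclideanSpace ℝ (Fin d)) y ∂nullLaw n d ∂uniformSphere d := by
    have hint := integrable_evalPoly_altLaw (n := n) hd I hw hw1 hI f
    rw [altLaw_eq_comp I hw hw1 hI, Measure.comp_eq_comp_const_apply] at hint ⊢
    rw [Kernel.integral_comp hint, Kernel.const_apply]
    refine integral_congr_ae (.of_forall fun v => ?_)
    exact integral_evalPoly_eq_integral_mul_truncatedLR
      (fun m => integrable_one_add_norm_pow_affineMixture (norm_eq_of_mem_sphere v) m)
      (sum_mul_self_eq_one v)
      (fun F hF => integral_eval_affineMixture hw (sum_mul_self_eq_one v) F hF) hf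
  obtain ⟨B, m, hB⟩ := exists_abs_truncatedLR_le lam n d D
  have hgauss : ∀ k : ℕ, Integrable (fun y : EuclideanSpace ℝ (Fin d) => (1 + ‖y‖) ^ k)
      (stdGaussian (EuclideanSpace ℝ (Fin d))) := integrable_one_add_norm_pow_stdGaussian
  have hM : MemLp (fun y : Fin n → EuclideanSpace ℝ (Fin d) => B * sampleWeight y ^ m) 2
      (nullLaw n d) := by
    have hcont : Continuous fun y : Fin n → EuclideanSpace ℝ (Fin d) => B * sampleWeight y ^ m := by
      unfold sampleWeight; fun_prop
    rw [memLp_two_iff_integrable_sq hcont.aestronglyMeasurable]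
    refine ((integrable_sampleWeight_pow hgauss (m * 2)).const_mul (B ^ 2)).congr
      (.of_forall fun y => ?_)
    simp only
    ring
  have hf2 : MemLp (evalPoly f) 2 (nullLaw n d) := by
    rw [memLp_two_iff_integrable_sq (continuous_evalPoly f).aestronglyMeasurable]
    refine (integrable_evalPoly hgauss (f ^ 2)).congr (.of_forall fun y => ?_)
    simp [evalPoly]
  have hLm : Measurable (Function.uncurry fun (v : UnitSphere d) y =>
      truncatedLR (n := n) lam D (v : EuclideanSpace ℝ (Fin d)) y) := by
    exact measurable_uncurry_truncatedLR lam n d D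
  have hA : ∫ v : UnitSphere d, ∫ v' : UnitSphere d, ∫ y,
      truncatedLR lam D (v : EuclideanSpace ℝ (Fin d)) y
        * truncatedLR lam D (v' : EuclideanSpace ℝ (Fin d)) y
        ∂nullLaw n d ∂uniformSphere d ∂uniformSphere d ≤ C ^ 2 := by
    have hin : ∀ v : UnitSphere d, ∫ v' : UnitSphere d, ∫ y,
        truncatedLR lam D (v : EuclideanSpace ℝ (Fin d)) y
          * truncatedLR lam D (v' : EuclideanSpace ℝ (Fin d)) y ∂nullLaw n d ∂uniformSphere d
        ≤ C ^ 2 := by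
      intro v
      have hrho : ∀ k : ℕ, Integrable (fun v' : UnitSphere d =>
          (∑ j, (v : EuclideanSpace ℝ (Fin d)) j * (v' : EuclideanSpace ℝ (Fin d)) j) ^ k)
          (uniformSphere d) := by
        intro k
        refine (integrable_const (1 : ℝ)).mono' (Continuous.aestronglyMeasurable (by
          simp_rw [sum_mul_eq_inner]; fun_prop)) (.of_forall fun v' => ?_)
        rw [norm_pow]
        refine pow_le_one₀ (norm_nonneg _) ?_
        exact (abs_sum_mul_le_norm (norm_eq_of_mem_sphere v) _).trans_eq (norm_eq_of_mem_sphere v')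
      simp_rw [fun v' : UnitSphere d => integral_truncatedLR_mul_truncatedLR (n := n) lam D
        (sum_mul_self_eq_one v) (sum_mul_self_eq_one v')]
      rw [integral_finsetSum _ fun t _ => (hrho _).const_mul _]
      refine le_trans ?_ hlam
      calc _ ≤ ∑ t ∈ degreePatterns n D,
            ∏ i, (lam (t i) ^ 2 / (t i).factorial * r ^ t i) := by
            refine Finset.sum_le_sum fun t ht => ?_
            rw [integral_const_mul, Finset.prod_mul_distrib, Finset.prod_pow_eq_pow_sum]
            refine mul_le_mul_of_nonneg_left ?_
              (Finset.prod_nonneg fun i _ => by positivity)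
            refine le_of_eq_of_le (integral_congr_ae (.of_forall fun v' => ?_))
              (integral_inner_pow_le hd (Finset.mem_filter.1 ht).2 hr hrD v)
            simp only
            rw [sum_mul_eq_inner, real_inner_comm]
        _ ≤ ∑ t ∈ Fintype.piFinset fun _ : Fin n => Finset.range (D + 1),
            ∏ i, (lam (t i) ^ 2 / (t i).factorial * r ^ t i) :=
            Finset.sum_le_sum_of_subset_of_nonneg (Finset.filter_subset _ _)
              fun t _ _ => Finset.prod_nonneg fun i _ => by positivity
        _ = _ := by
            rw [← Finset.prod_univ_sum (fun _ : Fin n => Finset.range (D + 1))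
              (fun _ t => lam t ^ 2 / t.factorial * r ^ t)]
            simp
    by_cases hint : Integrable (fun v : UnitSphere d => ∫ v' : UnitSphere d, ∫ y,
        truncatedLR lam D (v : EuclideanSpace ℝ (Fin d)) y
          * truncatedLR lam D (v' : EuclideanSpace ℝ (Fin d)) y ∂nullLaw n d ∂uniformSphere d)
        (uniformSphere d)
    · simpa using integral_mono hint (integrable_const (C ^ 2)) hin
    · rw [integral_undef hint]
      positivity
  have key := sq_integral_integral_mul_le hLm hM
    (fun v y => hB v (norm_eq_of_mem_sphere v) y) hf2 hA
  rw [hmean]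
  refine (le_abs_self _).trans (abs_le_of_sq_le_sq ?_ (by positivity))
  rw [mul_pow, Real.sq_sqrt hpos.le, mul_comm]
  exact key

end Advantage

/-! ### Moment matching and the hard instance -/

section Moments

theorem abs_hermiteMoment_le {a b X : ℝ} (hX : 1 ≤ X) (ha : |a| ≤ X) (hb : |b ^ 2 - 1| ≤ 1) (t : ℕ) :
    |hermiteMoment a b t| ≤ (2 * X) ^ t * √(t.factorial : ℝ) := by
  induction t using Nat.twoStepInduction with
  | zero => simp [hermiteMoment]
  | one => simp only [hermiteMoment, pow_one, Nat.factorial_one, Nat.cast_one, Real.sqrt_one]; linarith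
  | more t ih ih' =>
    have h1 : √((t + 1).factorial : ℝ) ≤ √((t + 2).factorial : ℝ) :=
      Real.sqrt_le_sqrt (by exact_mod_cast Nat.factorial_le (by omega))
    have h2 : ((t : ℝ) + 1) * √(t.factorial : ℝ) ≤ √((t + 2).factorial : ℝ) := by
      refine Real.le_sqrt_of_sq_le ?_
      rw [mul_pow, Real.sq_sqrt (by positivity), Nat.factorial_succ, Nat.factorial_succ]
      push_cast
      have : (0 : ℝ) < t.factorial := by positivity
      have h3 : ((t : ℝ) + 1) ^ 2 ≤ (t + 1 + 1) * (t + 1) := by nlinarith [Nat.cast_nonneg (α := ℝ) t]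
      nlinarith
    have h4 : |a * hermiteMoment a b (t + 1)|
        ≤ X * ((2 * X) ^ (t + 1) * √((t + 2).factorial : ℝ)) := by
      rw [abs_mul]
      exact mul_le_mul ha (ih'.trans (mul_le_mul_of_nonneg_left h1 (by positivity)))
        (abs_nonneg _) (by positivity)
    have h5 : |(b ^ 2 - 1) * (t + 1) * hermiteMoment a b t|
        ≤ (2 * X) ^ t * √((t + 2).factorial : ℝ) := by
      rw [abs_mul, abs_mul, abs_of_nonneg (by positivity : (0 : ℝ) ≤ (t : ℝ) + 1)]
      calc |b ^ 2 - 1| * (t + 1) * |hermiteMoment a b t|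
          ≤ 1 * (t + 1) * ((2 * X) ^ t * √(t.factorial : ℝ)) := by gcongr
        _ = (2 * X) ^ t * ((t + 1) * √(t.factorial : ℝ)) := by ring
        _ ≤ _ := by gcongr
    have h6 : 0 ≤ (2 * X) ^ t * √((t + 2).factorial : ℝ) := by positivity
    have h7 : (2 * X) ^ t * √((t + 2).factorial : ℝ)
        ≤ X ^ 2 * ((2 * X) ^ t * √((t + 2).factorial : ℝ)) :=
      le_mul_of_one_le_left h6 (one_le_pow₀ hX)
    calc |hermiteMoment a b (t + 2)| ≤ _ + _ := by rw [hermiteMoment]; exact abs_add_le _ _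
      _ ≤ X * ((2 * X) ^ (t + 1) * √((t + 2).factorial : ℝ))
          + (2 * X) ^ t * √((t + 2).factorial : ℝ) := add_le_add h4 h5
      _ ≤ (2 * X) ^ (t + 2) * √((t + 2).factorial : ℝ) := by
        rw [pow_succ, pow_add]
        nlinarith

/-- A distribution on two points with prescribed first three moments. The two points are the roots of
`x² = u x + c`, where `u` and `c` are determined by the moments. -/
theorem exists_two_point_moments {m₁ m₂ m₃ : ℝ} (h : m₁ ^ 2 < m₂) :
    ∃ p r₁ r₂ : ℝ, 0 ≤ p ∧ p ≤ 1 ∧ p * r₁ + (1 - p) * r₂ = m₁ ∧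
      p * r₁ ^ 2 + (1 - p) * r₂ ^ 2 = m₂ ∧ p * r₁ ^ 3 + (1 - p) * r₂ ^ 3 = m₃ ∧
      ∃ u : ℝ, u * (m₂ - m₁ ^ 2) = m₃ - m₁ * m₂ ∧
        r₁ ^ 2 = u * r₁ + (m₂ - u * m₁) ∧ r₂ ^ 2 = u * r₂ + (m₂ - u * m₁) := by
  have hV : 0 < m₂ - m₁ ^ 2 := by linarith
  obtain ⟨u, hu⟩ : ∃ u : ℝ, u * (m₂ - m₁ ^ 2) = m₃ - m₁ * m₂ :=
    ⟨(m₃ - m₁ * m₂) / (m₂ - m₁ ^ 2), div_mul_cancel₀ _ hV.ne'⟩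
  set δ : ℝ := √((u - 2 * m₁) ^ 2 + 4 * (m₂ - m₁ ^ 2)) with hδ
  have hδ2 : δ ^ 2 = (u - 2 * m₁) ^ 2 + 4 * (m₂ - m₁ ^ 2) := Real.sq_sqrt (by positivity)
  have hδ0 : 0 < δ := Real.sqrt_pos.2 (by positivity)
  have habs : |u - 2 * m₁| ≤ δ := Real.abs_le_sqrt (by linarith)
  obtain ⟨hl, hr⟩ := abs_le.1 habs
  set p : ℝ := (m₁ - (u - δ) / 2) / δ with hp
  have hpδ : p * δ = m₁ - (u - δ) / 2 := div_mul_cancel₀ _ hδ0.ne'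
  have e1 : ((u + δ) / 2) ^ 2 = u * ((u + δ) / 2) + (m₂ - u * m₁) := by nlinarith
  have e2 : ((u - δ) / 2) ^ 2 = u * ((u - δ) / 2) + (m₂ - u * m₁) := by nlinarith
  have f1 : p * ((u + δ) / 2) + (1 - p) * ((u - δ) / 2) = m₁ := by linarith
  have f2 : p * ((u + δ) / 2) ^ 2 + (1 - p) * ((u - δ) / 2) ^ 2 = m₂ := by
    rw [e1, e2]
    linear_combination u * f1
  refine ⟨p, (u + δ) / 2, (u - δ) / 2, div_nonneg (by linarith) hδ0.le,
    (div_le_one hδ0).2 (by linarith), f1, f2, ?_, u, hu, e1, e2⟩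
  linear_combination u * f2 + (m₂ - u * m₁) * f1 + hu + p * ((u + δ) / 2) * e1
    + (1 - p) * ((u - δ) / 2) * e2

theorem exists_bounded_two_point_moments {m₁ m₂ m₃ : ℝ} (b1 : |m₁| ≤ 1 / 2) (b2 : 3 / 4 ≤ m₂)
    (b2' : m₂ ≤ 1) (b3 : |m₃| ≤ 1 / 8) :
    ∃ p r₁ r₂ : ℝ, 0 ≤ p ∧ p ≤ 1 ∧ |r₁| ≤ 3 ∧ |r₂| ≤ 3 ∧ p * r₁ + (1 - p) * r₂ = m₁ ∧
      p * r₁ ^ 2 + (1 - p) * r₂ ^ 2 = m₂ ∧ p * r₁ ^ 3 + (1 - p) * r₂ ^ 3 = m₃ := by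
  have b1s : m₁ ^ 2 ≤ 1 / 4 := by
    have := pow_le_pow_left₀ (abs_nonneg _) b1 2
    rw [sq_abs] at this
    linarith
  obtain ⟨p, x₁, x₂, hp0, hp1, h1, h2, h3, u, hu, hx₁, hx₂⟩ :=
    exists_two_point_moments (m₁ := m₁) (m₂ := m₂) (m₃ := m₃) (by linarith)
  have hu1 : |u| ≤ 5 / 4 := by
    have hV : 1 / 2 ≤ m₂ - m₁ ^ 2 := by linarith
    have h4 : |m₃ - m₁ * m₂| ≤ 5 / 8 := by
      have h5 : |m₁ * m₂| ≤ 1 / 2 * 1 := by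
        rw [abs_mul]
        exact mul_le_mul b1 (abs_le.2 ⟨by linarith, b2'⟩) (abs_nonneg _) (by norm_num)
      have := abs_sub m₃ (m₁ * m₂)
      linarith
    rw [← hu, abs_mul, abs_of_nonneg (by linarith : 0 ≤ m₂ - m₁ ^ 2)] at h4
    have h5 := mul_le_mul_of_nonneg_left hV (abs_nonneg u)
    linarith
  have hc : m₂ - u * m₁ ≤ 13 / 8 := by
    have h5 : |u * m₁| ≤ 5 / 4 * (1 / 2) := by
      rw [abs_mul]
      exact mul_le_mul hu1 b1 (abs_nonneg _) (by norm_num)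
    have := (abs_le.1 h5).1
    linarith
  have hroot : ∀ x : ℝ, x ^ 2 = u * x + (m₂ - u * m₁) → |x| ≤ 3 := by
    intro x hx
    by_contra hcon
    push Not at hcon
    have h5 : u * x ≤ 5 / 4 * |x| := by
      calc u * x ≤ |u * x| := le_abs_self _
        _ = |u| * |x| := abs_mul _ _
        _ ≤ _ := by gcongr
    have h6 : x ^ 2 = |x| * |x| := by rw [abs_mul_abs_self, sq]
    have h7 : 3 * |x| ≤ |x| * |x| := mul_le_mul_of_nonneg_right hcon.le (abs_nonneg _)
    linarith
  exact ⟨p, x₁, x₂, hp0, hp1, hroot _ hx₁, hroot _ hx₂, h1, h2, h3⟩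

/-- The parameters of the one-dimensional hard distribution
`(1 - η) N(a, s²) + η (p δ_{r₁} + (1 - p) δ_{r₂})`: it has the first three moments of `N(0, 1)`, and its
outliers have size `O(1 / √η)`. -/
theorem exists_matching_parameters {η α : ℝ} (hη : 0 < η) (hη2 : η < 1 / 2) (hα : 0 < α) :
    ∃ s p r₁ r₂ : ℝ, 0 < s ∧ s ^ 2 = min (η / α ^ 2) (1 / 2) / 4 ∧ s ≤ 1 ∧ α * s ≤ 1 ∧
      0 ≤ p ∧ p ≤ 1 ∧ |r₁| ≤ 3 / √η ∧ |r₂| ≤ 3 / √η ∧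
      (1 - η) * (α * s) + η * (p * r₁ + (1 - p) * r₂) = 0 ∧
      (1 - η) * ((α * s) ^ 2 + s ^ 2) + η * (p * r₁ ^ 2 + (1 - p) * r₂ ^ 2) = 1 ∧
      (1 - η) * ((α * s) ^ 3 + 3 * (α * s) * s ^ 2)
        + η * (p * r₁ ^ 3 + (1 - p) * r₂ ^ 3) = 0 := by
  set q := min (η / α ^ 2) (1 / 2) with hq
  have hq0 : 0 < q := lt_min (by positivity) (by norm_num)
  have hq1 : q ≤ 1 / 2 := min_le_right _ _
  have hq2 : α ^ 2 * q ≤ η := by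
    calc α ^ 2 * q ≤ α ^ 2 * (η / α ^ 2) := by gcongr; exact min_le_left _ _
      _ = η := by field_simp
  set s := √(q / 4) with hs
  have hs0 : 0 < s := Real.sqrt_pos.2 (by positivity)
  have hs2 : s ^ 2 = q / 4 := Real.sq_sqrt (by positivity)
  set e := √η with he
  have he0 : 0 < e := Real.sqrt_pos.2 hη
  have he2 : e ^ 2 = η := Real.sq_sqrt hη.le
  have he1 : e < 1 := by nlinarith
  set a := α * s with ha
  have ha0 : 0 < a := by positivity
  have ha2 : a ^ 2 ≤ η / 4 := by rw [ha, mul_pow, hs2]; linarith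
  have hae : a ≤ e / 2 := by nlinarith
  have hs1 : s ^ 2 ≤ 1 / 8 := by linarith
  have hη1 : 0 < 1 - η := by linarith
  -- The first three moments of the outliers, multiplied by `√η`, `η` and `η √η`.
  set m₁ := -((1 - η) * a / e) with hm₁
  set m₂ := 1 - (1 - η) * (a ^ 2 + s ^ 2) with hm₂
  set m₃ := -(e * ((1 - η) * (a ^ 3 + 3 * a * s ^ 2))) with hm₃
  have b1 : |m₁| ≤ 1 / 2 := by
    rw [hm₁, abs_neg, abs_of_nonneg (by positivity), div_le_iff₀ he0]
    nlinarith
  have b2 : 3 / 4 ≤ m₂ := by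
    have : (1 - η) * (a ^ 2 + s ^ 2) ≤ 1 * (a ^ 2 + s ^ 2) := by gcongr; linarith
    linarith
  have b2' : m₂ ≤ 1 := by
    have : 0 ≤ (1 - η) * (a ^ 2 + s ^ 2) := by positivity
    linarith
  have b3 : |m₃| ≤ 1 / 8 := by
    rw [hm₃, abs_neg, abs_of_nonneg (by positivity)]
    have h1 : a ^ 3 + 3 * a * s ^ 2 ≤ 1 / 4 := by
      have h2 : a ^ 3 + 3 * a * s ^ 2 = a * (a ^ 2 + 3 * s ^ 2) := by ring
      rw [h2]
      calc a * (a ^ 2 + 3 * s ^ 2) ≤ (1 / 2) * (1 / 2) := by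
            gcongr <;> linarith
        _ = 1 / 4 := by norm_num
    have h3 : e * (1 - η) ≤ 1 / 2 := by
      have h5 := sq_nonneg (e - 1 / 2)
      nlinarith
    have h6 : 0 ≤ a ^ 3 + 3 * a * s ^ 2 := by positivity
    calc e * ((1 - η) * (a ^ 3 + 3 * a * s ^ 2)) = (e * (1 - η)) * (a ^ 3 + 3 * a * s ^ 2) := by
          ring
      _ ≤ (1 / 2) * (1 / 4) := by gcongr
      _ = _ := by norm_num
  obtain ⟨p, x₁, x₂, hp0, hp1, hx₁, hx₂, h1, h2, h3⟩ :=
    exists_bounded_two_point_moments b1 b2 b2' b3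
  have hroot : ∀ x : ℝ, |x| ≤ 3 → |x / e| ≤ 3 / e := by
    intro x hx
    rw [abs_div, abs_of_pos he0]
    gcongr
  refine ⟨s, p, x₁ / e, x₂ / e, hs0, hs2, by nlinarith, by linarith, hp0, hp1, hroot _ hx₁,
    hroot _ hx₂, ?_, ?_, ?_⟩
  · have : p * (x₁ / e) + (1 - p) * (x₂ / e) = m₁ / e := by rw [← h1]; ring
    rw [this, hm₁, ← he2]
    field_simp
    ring
  · have : p * (x₁ / e) ^ 2 + (1 - p) * (x₂ / e) ^ 2 = m₂ / e ^ 2 := by rw [← h2]; ring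
    rw [this, he2, mul_div_cancel₀ _ hη.ne', hm₂]
    ring
  · have : p * (x₁ / e) ^ 3 + (1 - p) * (x₂ / e) ^ 3 = m₃ / e ^ 3 := by rw [← h3]; ring
    rw [this, hm₃, ← he2]
    field_simp
    ring

/-- The weights of the three components of the hard distribution. -/
def hardWeight (η p : ℝ) : Fin 3 → ℝ := ![1 - η, η * p, η * (1 - p)]

theorem hardWeight_nonneg {η p : ℝ} (hη : 0 ≤ η) (hη1 : η ≤ 1) (hp : 0 ≤ p) (hp1 : p ≤ 1)
    (c : Fin 3) : 0 ≤ hardWeight η p c := by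
  fin_cases c
  · simp [hardWeight, hη1]
  · simp [hardWeight]; positivity
  · exact mul_nonneg hη (sub_nonneg.2 hp1)

theorem sum_hardWeight (η p : ℝ) : ∑ c, hardWeight η p c = 1 := by
  simp [hardWeight, Fin.sum_univ_three]; ring

theorem sq_mixtureMoment_div_factorial_le {η p s a r₁ r₂ : ℝ} (hη : 0 < η) (hη1 : η < 1 / 2)
    (hp : 0 ≤ p) (hp1 : p ≤ 1) (hs : 0 ≤ s) (hs1 : s ≤ 1) (ha : 0 ≤ a) (ha1 : a ≤ 1)
    (hr₁ : |r₁| ≤ 3 / √η) (hr₂ : |r₂| ≤ 3 / √η) {t : ℕ} (ht : 2 ≤ t) :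
    mixtureMoment (hardWeight η p) ![a, r₁, r₂] ![s, 0, 0] t ^ 2 / t.factorial
      ≤ 4 * η ^ 2 * (36 / η) ^ t := by
  have he0 : 0 < √η := Real.sqrt_pos.2 hη
  have he2 : √η ^ 2 = η := Real.sq_sqrt hη.le
  set X := 3 / √η with hXdef
  have hX2 : X ^ 2 = 9 / η := by rw [hXdef, div_pow, he2]; norm_num
  have hX : 1 ≤ X := by
    rw [hXdef, le_div_iff₀ he0]
    nlinarith
  have k0 := abs_hermiteMoment_le (X := 1) le_rfl (abs_le.2 ⟨by linarith, ha1⟩)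
    (b := s) (abs_le.2 ⟨by nlinarith, by nlinarith⟩) t
  have k1 := abs_hermiteMoment_le hX hr₁ (b := 0) (by norm_num) t
  have k2 := abs_hermiteMoment_le hX hr₂ (b := 0) (by norm_num) t
  set f := √(t.factorial : ℝ) with hf
  have hf2 : f ^ 2 = t.factorial := Real.sq_sqrt (by positivity)
  have hf0 : 0 < f := Real.sqrt_pos.2 (by positivity)
  -- The inliers contribute less than the bound on the outliers.
  have hin : (2 * 1 : ℝ) ^ t ≤ η * (2 * X) ^ t := by
    have h1 : 1 ≤ η * X ^ t := by
      calc (1 : ℝ) ≤ η * X ^ 2 := by rw [hX2, mul_div_cancel₀ _ hη.ne']; norm_num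
        _ ≤ η * X ^ t := by gcongr
    rw [mul_one, mul_pow]
    have : (0 : ℝ) < 2 ^ t := by positivity
    nlinarith
  have habs : |mixtureMoment (hardWeight η p) ![a, r₁, r₂] ![s, 0, 0] t|
      ≤ 2 * η * (2 * X) ^ t * f := by
    have h0 : 0 ≤ 1 - p := by linarith
    have h1 : 0 ≤ 1 - η := by linarith
    have hsum : mixtureMoment (hardWeight η p) ![a, r₁, r₂] ![s, 0, 0] t
        = (1 - η) * hermiteMoment a s t
          + (η * p * hermiteMoment r₁ 0 t + η * (1 - p) * hermiteMoment r₂ 0 t) := by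
      simp [mixtureMoment, hardWeight, Fin.sum_univ_three]
      ring
    rw [hsum]
    calc _ ≤ |(1 - η) * hermiteMoment a s t|
          + (|η * p * hermiteMoment r₁ 0 t| + |η * (1 - p) * hermiteMoment r₂ 0 t|) :=
          (abs_add_le _ _).trans (add_le_add_right (abs_add_le _ _) _)
      _ = (1 - η) * |hermiteMoment a s t|
          + (η * p * |hermiteMoment r₁ 0 t| + η * (1 - p) * |hermiteMoment r₂ 0 t|) := by
          rw [abs_mul, abs_mul (η * p), abs_mul (η * (1 - p)), abs_of_nonneg h1,
            abs_of_nonneg (by positivity : 0 ≤ η * p), abs_of_nonneg (by positivity : 0 ≤ η * (1 - p))]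
      _ ≤ 1 * ((η * (2 * X) ^ t) * f)
          + (η * p * ((2 * X) ^ t * f) + η * (1 - p) * ((2 * X) ^ t * f)) := by
          have h2 : |hermiteMoment a s t| ≤ (η * (2 * X) ^ t) * f :=
            k0.trans (by gcongr)
          have h3 : 1 - η ≤ 1 := by linarith
          gcongr
      _ = _ := by ring
  rw [div_le_iff₀ (by positivity), ← hf2, ← sq_abs]
  calc _ ≤ (2 * η * (2 * X) ^ t * f) ^ 2 := by gcongr
    _ = 4 * η ^ 2 * ((2 * X) ^ 2) ^ t * f ^ 2 := by
      rw [← pow_mul (2 * X) 2 t, mul_comm 2 t, pow_mul]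
      ring
    _ = _ := by
      have h4 : (2 * X) ^ 2 = 36 / η := by rw [mul_pow, hX2]; ring
      rw [h4]

/-- A truncated power series that starts with `1`, whose next three coefficients vanish and whose
further coefficients decay geometrically. -/
theorem sum_range_mul_pow_le {g : ℕ → ℝ} {A q r : ℝ} (hA : 0 ≤ A) (hq : 0 ≤ q) (hr : 0 ≤ r)
    (hz : q * r ≤ 1 / 2) (h0 : g 0 = 1) (h1 : g 1 = 0) (h2 : g 2 = 0) (h3 : g 3 = 0)
    (hg0 : ∀ t, 0 ≤ g t) (hg : ∀ t, 4 ≤ t → g t ≤ A * q ^ t) (D : ℕ) :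
    ∑ t ∈ Finset.range (D + 1), g t * r ^ t ≤ 1 + 2 * A * (q * r) ^ 4 := by
  have hz0 : 0 ≤ q * r := by positivity
  calc ∑ t ∈ Finset.range (D + 1), g t * r ^ t
      ≤ ∑ t ∈ Finset.range (D + 4), g t * r ^ t :=
        Finset.sum_le_sum_of_subset_of_nonneg (Finset.range_subset_range.2 (by omega))
          fun t _ _ => mul_nonneg (hg0 t) (by positivity)
    _ = ∑ t ∈ Finset.range D, g (t + 4) * r ^ (t + 4) + 1 := by
        rw [Finset.sum_range_succ', Finset.sum_range_succ', Finset.sum_range_succ',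
          Finset.sum_range_succ']
        simp [h0, h1, h2, h3]
    _ ≤ ∑ t ∈ Finset.range D, (A * (q * r) ^ 4) * (1 / 2) ^ t + 1 := by
        refine add_le_add_left (Finset.sum_le_sum fun t _ => ?_) _
        calc g (t + 4) * r ^ (t + 4) ≤ (A * q ^ (t + 4)) * r ^ (t + 4) := by
              gcongr; exact hg _ (by omega)
          _ = (A * (q * r) ^ 4) * (q * r) ^ t := by ring
          _ ≤ _ := by gcongr
    _ ≤ (A * (q * r) ^ 4) * 2 + 1 := by
        rw [← Finset.mul_sum]
        gcongr
        exact sum_geometric_two_le D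
    _ = _ := by ring

end Moments

section HardInstance

variable {d : ℕ}

/-- The matrix `I + (τ - 1) v vᵀ`, which scales the direction of the unit vector `v` by `τ`. -/
noncomputable def scaleMatrix (v : EuclideanSpace ℝ (Fin d)) (τ : ℝ) : Matrix (Fin d) (Fin d) ℝ :=
  1 + (τ - 1) • Matrix.vecMulVec v v

theorem scaleMatrix_mulVec (v : EuclideanSpace ℝ (Fin d)) (τ : ℝ) (x : Fin d → ℝ) :
    (scaleMatrix v τ).mulVec x = x + ((τ - 1) * (v ⬝ᵥ x)) • (v : Fin d → ℝ) := by
  rw [scaleMatrix, Matrix.add_mulVec, Matrix.one_mulVec, Matrix.smul_mulVec,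
    Matrix.vecMulVec_mulVec]
  ext i
  simp
  ring

theorem dotProduct_self_unitSphere (v : UnitSphere d) :
    (v : EuclideanSpace ℝ (Fin d)) ⬝ᵥ (v : EuclideanSpace ℝ (Fin d)) = 1 :=
  sum_mul_self_eq_one v

theorem scaleMatrix_mul (v : UnitSphere d) (τ τ' : ℝ) :
    scaleMatrix (v : EuclideanSpace ℝ (Fin d)) τ * scaleMatrix v τ' = scaleMatrix v (τ * τ') := by
  refine Matrix.ext_of_mulVec_single fun i => ?_
  rw [← Matrix.mulVec_mulVec]
  simp only [scaleMatrix_mulVec, dotProduct_add, dotProduct_smul, dotProduct_self_unitSphere]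
  ext j
  simp
  ring

theorem scaleMatrix_one (v : EuclideanSpace ℝ (Fin d)) : scaleMatrix v 1 = 1 := by
  simp [scaleMatrix]

theorem scaleMatrix_inv (v : UnitSphere d) {τ : ℝ} (hτ : τ ≠ 0) :
    (scaleMatrix (v : EuclideanSpace ℝ (Fin d)) τ)⁻¹ = scaleMatrix v τ⁻¹ :=
  Matrix.inv_eq_right_inv (by rw [scaleMatrix_mul, mul_inv_cancel₀ hτ, scaleMatrix_one])

theorem isHermitian_scaleMatrix (v : EuclideanSpace ℝ (Fin d)) (τ : ℝ) :
    (scaleMatrix v τ).IsHermitian := by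
  ext i j
  simp [scaleMatrix, Matrix.vecMulVec_apply, Matrix.one_apply, eq_comm, mul_comm]

theorem le_dotProduct_scaleMatrix (v : UnitSphere d) {τ : ℝ} (hτ : τ ≤ 1) (x : Fin d → ℝ) :
    τ * (x ⬝ᵥ x) ≤ x ⬝ᵥ (scaleMatrix (v : EuclideanSpace ℝ (Fin d)) τ).mulVec x := by
  rw [scaleMatrix_mulVec, dotProduct_add, dotProduct_smul, smul_eq_mul, dotProduct_comm x (v : _)]
  have h : ((v : EuclideanSpace ℝ (Fin d)) ⬝ᵥ x) ^ 2 ≤ x ⬝ᵥ x := by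
    have h1 := Finset.sum_mul_sq_le_sq_mul_sq Finset.univ
      (fun j => (v : EuclideanSpace ℝ (Fin d)) j) x
    have h2 := sum_mul_self_eq_one v
    simp only [← sq] at h2
    rw [h2, one_mul] at h1
    simpa [dotProduct, sq] using h1
  nlinarith

theorem posDef_scaleMatrix (v : UnitSphere d) {τ : ℝ} (hτ0 : 0 < τ) (hτ : τ ≤ 1) :
    (scaleMatrix (v : EuclideanSpace ℝ (Fin d)) τ).PosDef := by
  refine Matrix.PosDef.of_dotProduct_mulVec_pos (isHermitian_scaleMatrix _ _) fun x hx => ?_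
  rw [star_trivial]
  refine lt_of_lt_of_le (mul_pos hτ0 ?_) (le_dotProduct_scaleMatrix v hτ x)
  exact lt_of_le_of_ne (Finset.sum_nonneg fun i _ => mul_self_nonneg _)
    (Ne.symm (mt dotProduct_self_eq_zero.1 hx))

theorem sqrt_scaleMatrix_sq (v : UnitSphere d) {s : ℝ} (hs0 : 0 < s) (hs : s ≤ 1) :
    CFC.sqrt (scaleMatrix (v : EuclideanSpace ℝ (Fin d)) (s ^ 2)) = scaleMatrix v s :=
  CFC.sqrt_unique (by rw [scaleMatrix_mul, sq]) (posDef_scaleMatrix v hs0 hs).posSemidef.nonneg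

theorem toEuclideanCLM_scaleMatrix (v : EuclideanSpace ℝ (Fin d)) (τ : ℝ)
    (y : EuclideanSpace ℝ (Fin d)) :
    Matrix.toEuclideanCLM (𝕜 := ℝ) (scaleMatrix v τ) y = y + ((τ - 1) * inner ℝ v y) • v := by
  ext j
  rw [Matrix.ofLp_toEuclideanCLM, scaleMatrix_mulVec, ← sum_mul_eq_inner]
  rfl

theorem multivariateGaussian_scaleMatrix (v : UnitSphere d) (a : ℝ) {s : ℝ} (hs0 : 0 < s)
    (hs : s ≤ 1) :
    multivariateGaussian (a • (v : EuclideanSpace ℝ (Fin d)))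
      (scaleMatrix (v : EuclideanSpace ℝ (Fin d)) (s ^ 2))
      = (stdGaussian (EuclideanSpace ℝ (Fin d))).map (affineMap a s v) := by
  rw [multivariateGaussian, sqrt_scaleMatrix_sq v hs0 hs]
  congr 1
  funext y
  rw [toEuclideanCLM_scaleMatrix, affineMap]
  module

theorem mahalanobisNorm_scaleMatrix (v : UnitSphere d) {a s : ℝ} (ha : 0 ≤ a) (hs0 : 0 < s)
    (hs : s ≤ 1) :
    mahalanobisNorm (scaleMatrix (v : EuclideanSpace ℝ (Fin d)) (s ^ 2))
      (a • (v : EuclideanSpace ℝ (Fin d))) = a / s := by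
  rw [mahalanobisNorm, sqrt_scaleMatrix_sq v hs0 hs, scaleMatrix_inv v hs0.ne',
    toEuclideanCLM_scaleMatrix, real_inner_smul_right, real_inner_self_eq_norm_sq,
    norm_eq_of_mem_sphere]
  have h : a • (v : EuclideanSpace ℝ (Fin d)) + ((s⁻¹ - 1) * (a * 1 ^ 2)) • v.1
      = (a / s) • (v : EuclideanSpace ℝ (Fin d)) := by
    rw [← add_smul]
    congr 1
    field_simp
    ring
  rw [h, norm_smul, norm_eq_of_mem_sphere, mul_one, Real.norm_of_nonneg (by positivity)]

/-- The outliers: along `v`, they take the values `r₁` and `r₂` with probabilities `p` and `1 - p`. -/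
noncomputable def twoPointOutlier (p r₁ r₂ : ℝ) (v : UnitSphere d) :
    Measure (EuclideanSpace ℝ (Fin d)) :=
  affineMixture ![p, 1 - p] ![r₁, r₂] ![0, 0] (v : EuclideanSpace ℝ (Fin d))

theorem contaminatedGaussian_eq_affineMixture {η p s a r₁ r₂ : ℝ} (hη : 0 ≤ η)
    (hs0 : 0 < s) (hs : s ≤ 1) (v : UnitSphere d) :
    contaminatedGaussian η (a • (v : EuclideanSpace ℝ (Fin d)))
      (scaleMatrix (v : EuclideanSpace ℝ (Fin d)) (s ^ 2)) (twoPointOutlier p r₁ r₂ v)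
      = affineMixture (hardWeight η p) ![a, r₁, r₂] ![s, 0, 0]
        (v : EuclideanSpace ℝ (Fin d)) := by
  rw [contaminatedGaussian, multivariateGaussian_scaleMatrix v a hs0 hs]
  simp only [twoPointOutlier, affineMixture, Fin.sum_univ_two, Fin.sum_univ_three, hardWeight,
    Matrix.cons_val_zero, Matrix.cons_val_one, Matrix.cons_val]
  rw [smul_add, smul_smul, smul_smul, ← ENNReal.ofReal_mul hη, ← ENNReal.ofReal_mul hη, add_assoc]

/-- The hard instance. -/
noncomputable def hardInstance (d : ℕ) {η α s p : ℝ} (r₁ r₂ : ℝ) (hη : 0 ≤ η) (hα : 0 ≤ α)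
    (hs0 : 0 < s) (hs : s ≤ 1) (hp : 0 ≤ p) (hp1 : p ≤ 1) : MeanTestingInstance d η α where
  mean v := (α * s) • (v : EuclideanSpace ℝ (Fin d))
  cov v := scaleMatrix (v : EuclideanSpace ℝ (Fin d)) (s ^ 2)
  outlier v := twoPointOutlier p r₁ r₂ v
  cov_posDef v := posDef_scaleMatrix v (by positivity) (pow_le_one₀ hs0.le hs)
  outlier_isProbabilityMeasure v := by
    refine isProbabilityMeasure_affineMixture (fun c => ?_) (by simp) _
    fin_cases c
    · exact hp
    · exact sub_nonneg.2 hp1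
  le_mahalanobisNorm v := by
    rw [mahalanobisNorm_scaleMatrix v (by positivity) hs0 hs, mul_div_cancel_right₀ _ hs0.ne']
  measurable_sample := by
    simp_rw [fun v : UnitSphere d => contaminatedGaussian_eq_affineMixture (p := p) (a := α * s)
      (r₁ := r₁) (r₂ := r₂) hη hs0 hs v]
    exact (measurable_affineMixture _ _ _).comp measurable_subtype_coe

theorem le_of_hasEigenvalue_scaleMatrix (v : UnitSphere d) {τ l : ℝ} (hτ : τ ≤ 1)
    (hl : Module.End.HasEigenvalue
      (Matrix.toLin' (scaleMatrix (v : EuclideanSpace ℝ (Fin d)) τ)) l) : τ ≤ l := by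
  obtain ⟨x, hx⟩ := hl.exists_hasEigenvector
  have h1 := hx.apply_eq_smul
  rw [Matrix.toLin'_apply] at h1
  have h2 := le_dotProduct_scaleMatrix v hτ x
  rw [h1, dotProduct_smul, smul_eq_mul] at h2
  refine le_of_mul_le_mul_right h2 ?_
  exact lt_of_le_of_ne (Finset.sum_nonneg fun i _ => mul_self_nonneg _)
    (Ne.symm (mt dotProduct_self_eq_zero.1 hx.2))

end HardInstance

/-- Low-degree hardness of covariance-aware robust mean testing. The constants `K`, `k`, `C`, `c`
are absolute; the instance `I` depends on `d`, `η`, `α` only. -/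
theorem theorem8p9 :
    ∃ (K : ℝ) (k : ℕ) (C c : ℝ), 0 < K ∧ 0 < c ∧
      ∀ (d : ℕ) (η α : ℝ), 0 < η → η < 1 / 2 → K ≤ η * √(d : ℝ) → 0 < α →
        ∃ I : MeanTestingInstance d η α,
          (∀ v : UnitSphere d, ∀ l : ℝ,
            Module.End.HasEigenvalue (Matrix.toLin' (I.cov v)) l →
              c * min (η / α ^ 2) (1 / 2) ≤ l) ∧
          (∀ (n : ℕ) (f : MvPolynomial (Fin n × Fin d) ℝ),
            Integrable (evalPoly f) (I.altLaw n)) ∧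
          ∀ n D : ℕ, K * (d : ℝ) ≤ n → (n : ℝ) * (K * (D : ℝ) ^ k) ≤ (d : ℝ) ^ 2 * η ^ 2 →
            degreeAdvantage D (nullLaw n d) (I.altLaw n) ≤ (C : EReal) := by
  obtain ⟨K, hK⟩ : ∃ K : ℝ, K = 32 * 36 ^ 4 := ⟨_, rfl⟩
  have hK0 : 0 < K := by norm_num [hK]
  refine ⟨K, 2, 2, 1 / 4, hK0, by norm_num, fun d η α hη hη2 hKd hα => ?_⟩
  have hd : 1 ≤ d := by
    rcases Nat.eq_zero_or_pos d with rfl | h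
    · rw [Nat.cast_zero, Real.sqrt_zero, mul_zero] at hKd
      linarith
    · exact h
  have hd' : (0 : ℝ) < d := by exact_mod_cast hd
  obtain ⟨s, p, r₁, r₂, hs0, hs2, hs1, ha1, hp0, hp1, hr₁, hr₂, hm1, hm2, hm3⟩ :=
    exists_matching_parameters hη hη2 hα
  have hw := hardWeight_nonneg hη.le (by linarith) hp0 hp1
  have hw1 := sum_hardWeight η p
  set I := hardInstance d r₁ r₂ hη.le hα.le hs0 hs1 hp0 hp1 with hI
  have hIs : ∀ v : UnitSphere d, I.sample v = affineMixture (hardWeight η p) ![α * s, r₁, r₂]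
      ![s, 0, 0] (v : EuclideanSpace ℝ (Fin d)) :=
    fun v => contaminatedGaussian_eq_affineMixture hη.le hs0 hs1 v
  refine ⟨I, fun v l hl => ?_, fun n f => integrable_evalPoly_altLaw hd I hw hw1 hIs f,
    fun n D hn hD => ?_⟩
  · have h := le_of_hasEigenvalue_scaleMatrix v (pow_le_one₀ hs0.le hs1) hl
    rw [hs2] at h
    linarith
  set lam := mixtureMoment (hardWeight η p) ![α * s, r₁, r₂] ![s, 0, 0] with hlam
  have hl0 : lam 0 = 1 := by
    simp [hlam, mixtureMoment, hermiteMoment, sum_hardWeight]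
  have hl1 : lam 1 = 0 := by
    rw [← hm1]
    simp [hlam, mixtureMoment, hermiteMoment, Fin.sum_univ_three, hardWeight]
    ring
  have hl2 : lam 2 = 0 := by
    have : lam 2 = (1 - η) * ((α * s) ^ 2 + s ^ 2)
        + η * (p * r₁ ^ 2 + (1 - p) * r₂ ^ 2) - 1 := by
      simp [hlam, mixtureMoment, hermiteMoment, Fin.sum_univ_three, hardWeight]
      ring
    rw [this, hm2, sub_self]
  have hl3 : lam 3 = 0 := by
    have : lam 3 = ((1 - η) * ((α * s) ^ 3 + 3 * (α * s) * s ^ 2)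
        + η * (p * r₁ ^ 3 + (1 - p) * r₂ ^ 3))
        - 3 * ((1 - η) * (α * s) + η * (p * r₁ + (1 - p) * r₂)) := by
      simp [hlam, mixtureMoment, hermiteMoment, Fin.sum_univ_three, hardWeight]
      ring
    rw [this, hm3, hm1, mul_zero, sub_zero]
  -- `r` bounds the typical overlap of two random directions at degree `D`.
  set r : ℝ := √(2 * D / d) with hr
  have hr2 : r ^ 2 = 2 * D / d := Real.sq_sqrt (by positivity)
  have hr0 : 0 ≤ r := Real.sqrt_nonneg _
  set z : ℝ := 36 / η * r with hz
  have hz0 : 0 ≤ z := by positivity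
  have hz4 : z ^ 4 = 4 * 36 ^ 4 * (D : ℝ) ^ 2 / (d ^ 2 * η ^ 4) := by
    have : z ^ 4 = (36 / η) ^ 4 * (r ^ 2) ^ 2 := by rw [hz]; ring
    rw [this, hr2]
    field_simp
    ring
  have hdη : K ^ 2 ≤ d * η ^ 2 := by
    have h : K ^ 2 ≤ (η * √(d : ℝ)) ^ 2 := pow_le_pow_left₀ (by positivity) hKd 2
    rwa [mul_pow, Real.sq_sqrt hd'.le, mul_comm] at h
  -- The lower bound on `n` turns the bound on `D² n` into one on `D²`.
  have hDd : K ^ 2 * (D : ℝ) ^ 2 ≤ d * η ^ 2 := by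
    have h1 : (K * d) * (K * (D : ℝ) ^ 2) ≤ (d : ℝ) ^ 2 * η ^ 2 :=
      le_trans (by gcongr) hD
    have h2 : d * (K ^ 2 * (D : ℝ) ^ 2) ≤ d * (d * η ^ 2) := by linarith
    exact le_of_mul_le_mul_left h2 hd'
  have hzhalf : z ≤ 1 / 2 := by
    refine le_of_pow_le_pow_left₀ (n := 4) (by norm_num) (by norm_num) ?_
    rw [hz4, div_le_iff₀ (by positivity)]
    have h1 : K ^ 2 * (K ^ 2 * (D : ℝ) ^ 2) ≤ (d * η ^ 2) * (d * η ^ 2) := by gcongr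
    have h2 : (d : ℝ) ^ 2 * η ^ 4 = (d * η ^ 2) * (d * η ^ 2) := by ring
    rw [h2]
    have h3 : (4 : ℝ) * 36 ^ 4 ≤ (1 / 2) ^ 4 * (K ^ 2 * K ^ 2) := by norm_num [hK]
    calc _ ≤ (1 / 2) ^ 4 * (K ^ 2 * K ^ 2) * (D : ℝ) ^ 2 := by gcongr
      _ = (1 / 2) ^ 4 * (K ^ 2 * (K ^ 2 * (D : ℝ) ^ 2)) := by ring
      _ ≤ _ := by gcongr
  refine degreeAdvantage_le hd I hw hw1 hIs hr0 (by rw [hr2, div_mul_cancel₀ _ hd'.ne'])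
    (by norm_num) ?_
  have hsum := sum_range_mul_pow_le (g := fun t => lam t ^ 2 / t.factorial) (A := 4 * η ^ 2)
    (q := 36 / η) (r := r) (by positivity) (by positivity) hr0 hzhalf (by simp [hl0])
    (by simp [hl1]) (by simp [hl2]) (by simp [hl3]) (fun t => by positivity)
    (fun t ht => sq_mixtureMoment_div_factorial_le hη hη2 hp0 hp1 hs0.le hs1
      (by positivity) ha1 hr₁ hr₂ (by omega)) D
  calc _ ≤ (1 + 2 * (4 * η ^ 2) * z ^ 4) ^ n :=
        pow_le_pow_left₀ (Finset.sum_nonneg fun t _ => by positivity) hsum n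
    _ ≤ Real.exp (2 * (4 * η ^ 2) * z ^ 4) ^ n := by
        gcongr
        rw [add_comm]
        exact Real.add_one_le_exp _
    _ = Real.exp (n * (2 * (4 * η ^ 2) * z ^ 4)) := (Real.exp_nat_mul _ _).symm
    _ ≤ Real.exp 1 := by
        refine Real.exp_le_exp.2 ?_
        have h1 : n * (2 * (4 * η ^ 2) * z ^ 4)
            = n * (K * (D : ℝ) ^ 2) / (d ^ 2 * η ^ 2) := by
          rw [hz4, hK]
          field_simp
          ring
        rw [h1]
        exact div_le_one_of_le₀ hD (by positivity)
    _ ≤ 2 ^ 2 := by linarith [Real.exp_one_lt_d9]
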